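/- Let $0<y<1$ and let $u:[0,\infty)\to(0,\infty)$ be twice differentiable, such that $\psi(t)=t\,u(t)$ is strictly increasing, $\lim_{t\to\infty}\psi(t)>y$ (the limit may be $+\infty$), and $t\,u'(t)<u(t)$ for all $t\ge 0$. For points $x_1,\dots,x_n\in\mathbb R^p$, Maronna's M-estimator $\bar\Sigma$ is the positive definite $p\times p$ matrix with $\bar\Sigma=\sum_{i=1}^n u(x_i^T\bar\Sigma^{-1}x_i)\,x_ix_i^T$. Let $\psi^{-1}(y)$ be the unique $t\geq 0$ with $\psi(t)=y$, and $\|\cdot\|$ the Euclidean operator norm. Then there exist $C,c,c'>0$, depending only on $y$ and $u$, such that for every $0<\varepsilon<c'$ there is $\delta>0$ with the following property. For all integers $n\ge1$ and $p$ with $|p/n-y|<\delta$ (thus for all $n$ if $p/n=y$, and for all sufficiently large $n$ if $p=p_n$ with $p_n/n\to y$), every positive definite $T_p\in\mathbb R^{p\times p}$, and i.i.d. samples $x_1,\dots,x_n$ from $N(0,T_p)$, with probability at least $1-Cne^{-c\varepsilon^2n}$ Maronna's M-estimator $\bar\Sigma$ exists, is unique, and satisfies $$\Big\|T_p^{-1/2}\Big(\frac{1}{n\,u(\psi^{-1}(y))}\,\bar\Sigma-\frac1n\sum_{i=1}^n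 x_ix_i^T\Big)T_p^{-1/2}\Big\|\le\varepsilon .$$ -/

import Mathlib

open MeasureTheory ProbabilityTheory Filter Topology
open scoped MatrixOrder

namespace Maronna

/-- `ψ(t) = t u(t)`. -/
def psi (u : ℝ → ℝ) (t : ℝ) : ℝ := t * u t

/-- The assumptions on the weight function `u : [0, ∞) → (0, ∞)` (only the values on `[0, ∞)`
matter; derivatives at `0` are one-sided). -/
structure WeightAssumptions (u : ℝ → ℝ) (y : ℝ) : Prop where
  pos : ∀ t, 0 ≤ t → 0 < u t
  psi_strictMono : StrictMonoOn (psi u) (Set.Ici 0)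
  psi_lim : ∃ L : EReal, Tendsto (fun t : ℝ => (psi u t : EReal)) atTop (𝓝 L) ∧ (y : EReal) < L
  differentiable : DifferentiableOn ℝ u (Set.Ici 0)
  differentiable_deriv : DifferentiableOn ℝ (derivWithin u (Set.Ici 0)) (Set.Ici 0)
  mul_deriv_lt : ∀ t, 0 ≤ t → t * derivWithin u (Set.Ici 0) t < u t

/-- The inverse `ψ⁻¹` of `ψ : [0, ∞) → [0, ∞)`. -/
noncomputable def psiInv (u : ℝ → ℝ) (y : ℝ) : ℝ :=
  Function.invFunOn (psi u) (Set.Ici 0) y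

/-- The value `ψ⁻¹(y)` is the unique `t ≥ 0` with `t u(t) = y`. -/
theorem psiInv_spec {u : ℝ → ℝ} {y : ℝ} (hy : 0 < y) (hu : WeightAssumptions u y) :
    0 ≤ psiInv u y ∧ psi u (psiInv u y) = y ∧
      ∀ t, 0 ≤ t → psi u t = y → t = psiInv u y := by
  have hc : ContinuousOn (psi u) (Set.Ici 0) :=
    continuousOn_id.mul hu.differentiable.continuousOn
  obtain ⟨L, hL, hyL⟩ := hu.psi_lim
  obtain ⟨b, hb, hb0⟩ := ((hL.eventually (lt_mem_nhds hyL)).and (eventually_ge_atTop 0)).exists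
  have hb' : y < psi u b := by exact_mod_cast hb
  have hmem : ∃ t ∈ Set.Ici (0 : ℝ), psi u t = y := by
    have h := intermediate_value_Icc hb0 (hc.mono Set.Icc_subset_Ici_self)
    have h0 : psi u 0 = 0 := by simp [psi]
    obtain ⟨t, ht, hty⟩ := h ⟨by rw [h0]; exact hy.le, hb'.le⟩
    exact ⟨t, ht.1, hty⟩
  have h1 : 0 ≤ psiInv u y := Function.invFunOn_mem hmem
  have h2 : psi u (psiInv u y) = y := Function.invFunOn_eq hmem
  exact ⟨h1, h2, fun t ht hty => hu.psi_strictMono.injOn ht h1 (hty.trans h2.symm)⟩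

/-- `x xᵀ`. -/
def outer {p : ℕ} (x : EuclideanSpace ℝ (Fin p)) : Matrix (Fin p) (Fin p) ℝ :=
  Matrix.vecMulVec x.ofLp x.ofLp

/-- The quadratic form `xᵀ M x`. -/
def quad {p : ℕ} (M : Matrix (Fin p) (Fin p) ℝ) (x : EuclideanSpace ℝ (Fin p)) : ℝ :=
  x.ofLp ⬝ᵥ (M.mulVec x.ofLp)

/-- `Σ` is a Maronna M-estimator of scatter of the sample `x₁, …, xₙ` for the weight function `u`:
a positive definite solution of `Σ = ∑ᵢ u(xᵢᵀ Σ⁻¹ xᵢ) xᵢ xᵢᵀ`. -/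
def IsMEstimator {n p : ℕ} (u : ℝ → ℝ) (x : Fin n → EuclideanSpace ℝ (Fin p))
    (S : Matrix (Fin p) (Fin p) ℝ) : Prop :=
  S.PosDef ∧ S = ∑ i, u (quad S⁻¹ (x i)) • outer (x i)

/-- The sample covariance matrix `(1/n) ∑ᵢ xᵢ xᵢᵀ`. -/
noncomputable def sampleCov {n p : ℕ} (x : Fin n → EuclideanSpace ℝ (Fin p)) :
    Matrix (Fin p) (Fin p) ℝ :=
  (1 / (n : ℝ)) • ∑ i, outer (x i)

/-- The operator norm of a square matrix for the Euclidean norm. -/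
noncomputable def opNorm {p : ℕ} (M : Matrix (Fin p) (Fin p) ℝ) : ℝ :=
  ‖Matrix.toEuclideanCLM (n := Fin p) (𝕜 := ℝ) M‖

/-- `T^{-1/2} M T^{-1/2}` for a positive definite matrix `T`, with `T^{1/2}` the positive definite
square root. -/
noncomputable def whiten {p : ℕ} (T M : Matrix (Fin p) (Fin p) ℝ) : Matrix (Fin p) (Fin p) ℝ :=
  (CFC.sqrt T)⁻¹ * M * (CFC.sqrt T)⁻¹

/-- For the sample `x`, the M-estimator `Σ̄` exists and is unique, and
`‖T^{-1/2} (Σ̄ / (n u(ψ⁻¹(y))) - (1/n) ∑ᵢ xᵢ xᵢᵀ) T^{-1/2}‖ ≤ ε`. -/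
def GoodSample {n p : ℕ} (u : ℝ → ℝ) (y : ℝ) (T : Matrix (Fin p) (Fin p) ℝ) (ε : ℝ)
    (x : Fin n → EuclideanSpace ℝ (Fin p)) : Prop :=
  (∃! S, IsMEstimator u x S) ∧
    ∀ S, IsMEstimator u x S →
      opNorm (whiten T ((1 / (n * u (psiInv u y))) • S - sampleCov x)) ≤ ε

end Maronna

/-! Write `S(w) = ∑ wᵢ xᵢ xᵢᵀ` and `lev x w i = xᵢᵀ S(w)⁻¹ xᵢ`. An M-estimator is `S(w)` for a
positive solution of `wᵢ = u (lev x w i)`. In logarithmic coordinates, `w ↦ lev x w` is nonexpansive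
for the sup distance, since it is antitone and homogeneous of degree -1. The map `u` strictly
shrinks distances, because `t u(t)` increases and `u(t)/t` decreases. When all unweighted leverages
`hᵢ = lev x 1 i` are near `y`, a ball around the constant weight `u(ψ⁻¹(y))` is mapped into itself,
and Edelstein's theorem gives existence; strictness gives uniqueness (`existsUnique_weights`).

The contraction by `u` has no uniform rate, so closeness of the weights to `u(ψ⁻¹(y))` needs another
source. If the squared entries of any two rows of the hat matrix are of order at least `1/n` at half
of the indices, passing from weights to leverages loses a definite part of the logarithmic spread
(`lev_ratio_le`). At a fixed point this makes the spread linear in that of the `hᵢ`. The trace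
identity `∑ wᵢ lev x w i = p` then fixes the common level near `ψ⁻¹(y)` (`exists_weights_close`).
The matrix error is a weighted scatter matrix with small weights, controlled by the norm of the
sample matrix.

After whitening, the sample matrix has i.i.d. standard Gaussian columns in `ℝⁿ`, and three estimates
remain, each failing with exponentially small probability. Rotation invariance replaces a basis
vector by an independent Gaussian vector, so each `hᵢ` concentrates at `p/n`
(`measure_leverage_dev_le`). The off-diagonal part of a hat-matrix row has a rotation-invariant
direction, so few of its entries are small (`measure_residual_smallCoords_le`). The norm of the
sample matrix is `O(√n)` (`measure_norm_design_gt_le`). -/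

namespace Maronna

/-! ### Strict contractions and the weight function in logarithmic coordinates -/

/-- Edelstein's fixed point theorem. -/
theorem exists_isFixedPt_of_dist_lt {X : Type*} [MetricSpace X] {K : Set X} (hK : IsCompact K)
    (hne : K.Nonempty) {f : X → X} (hmaps : Set.MapsTo f K K)
    (hf : ∀ x z, x ≠ z → dist (f x) (f z) < dist x z) : ∃ x ∈ K, f x = x := by
  have hcont : Continuous f := by
    refine (LipschitzWith.of_dist_le_mul (K := 1) fun x z => ?_).continuous
    rcases eq_or_ne x z with rfl | h
    · simp
    · simpa using (hf x z h).le
  -- A minimiser of the displacement is fixed: otherwise its image has strictly smaller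
  -- displacement.
  obtain ⟨x, hxK, hx⟩ := hK.exists_isMinOn hne (f := fun x => dist x (f x)) (by fun_prop)
  refine ⟨x, hxK, ?_⟩
  by_contra hne
  exact (hf x (f x) (Ne.symm hne)).not_ge (hx (hmaps hxK))

/-- The weight function in logarithmic coordinates. -/
noncomputable def logWeight (u : ℝ → ℝ) (s : ℝ) : ℝ := Real.log (u (Real.exp s))

theorem WeightAssumptions.div_strictAntiOn {u : ℝ → ℝ} {y : ℝ} (hu : WeightAssumptions u y) :
    StrictAntiOn (fun t => u t / t) (Set.Ioi 0) := by
  have hd : ∀ t : ℝ, 0 < t → HasDerivAt u (derivWithin u (Set.Ici 0) t) t := fun t ht =>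
    (hu.differentiable t ht.le).hasDerivWithinAt.hasDerivAt (Ici_mem_nhds ht)
  have hd' : ∀ t : ℝ, 0 < t → HasDerivAt (fun t => u t / t)
      ((derivWithin u (Set.Ici 0) t * t - u t * 1) / t ^ 2) t := fun t ht =>
    (hd t ht).div (hasDerivAt_id t) ht.ne'
  refine strictAntiOn_of_deriv_neg (convex_Ioi 0)
    (fun t ht => (hd' t ht).continuousAt.continuousWithinAt) fun t ht => ?_
  rw [interior_Ioi] at ht
  have ht' : 0 < t := ht
  rw [(hd' t ht').deriv]
  refine div_neg_of_neg_of_pos ?_ (by positivity)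
  have := hu.mul_deriv_lt t ht'.le
  linarith

/-- Monotonicity of `t u(t)` bounds the logarithmic slope below by -1, that of `u(t)/t` bounds it
above by 1. Both are strict only pointwise, so no Lipschitz constant below 1 is available. -/
theorem WeightAssumptions.abs_logWeight_sub_lt {u : ℝ → ℝ} {y : ℝ} (hu : WeightAssumptions u y)
    {s s' : ℝ} (hs : s ≠ s') : |logWeight u s - logWeight u s'| < |s - s'| := by
  wlog h : s' < s generalizing s s'
  · rw [abs_sub_comm, abs_sub_comm s]
    exact this hs.symm (lt_of_le_of_ne (not_lt.mp h) hs)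
  have he := Real.exp_lt_exp.mpr h
  have p1 := hu.pos _ (Real.exp_pos s).le
  have p2 := hu.pos _ (Real.exp_pos s').le
  rw [abs_of_pos (sub_pos.mpr h), abs_lt]
  constructor
  · have := Real.log_lt_log (by unfold psi; positivity)
      (hu.psi_strictMono (Real.exp_pos s').le (Real.exp_pos s).le he)
    unfold psi at this
    rw [Real.log_mul (Real.exp_pos _).ne' p2.ne', Real.log_mul (Real.exp_pos _).ne' p1.ne',
      Real.log_exp, Real.log_exp] at this
    unfold logWeight
    linarith
  · have := Real.log_lt_log (by positivity)
      (hu.div_strictAntiOn (Real.exp_pos s') (Real.exp_pos s) he)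
    rw [Real.log_div p1.ne' (Real.exp_pos _).ne', Real.log_div p2.ne' (Real.exp_pos _).ne',
      Real.log_exp, Real.log_exp] at this
    unfold logWeight
    linarith

theorem WeightAssumptions.abs_logWeight_sub_le {u : ℝ → ℝ} {y : ℝ} (hu : WeightAssumptions u y)
    (s s' : ℝ) : |logWeight u s - logWeight u s'| ≤ |s - s'| := by
  rcases eq_or_ne s s' with rfl | h
  · simp
  · exact (hu.abs_logWeight_sub_lt h).le

/-- Strict contraction between `c` and `c ± 1` leaves slack `η`; going a further `η` outwards costs
at most `η`. This slack absorbs the deviation of the leverages from `y` when a unit ball has to be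
mapped into itself. -/
theorem WeightAssumptions.exists_margin {u : ℝ → ℝ} {y : ℝ} (hu : WeightAssumptions u y) (c : ℝ) :
    ∃ η, 0 < η ∧ ∀ s, |s - c| ≤ 1 + η → |logWeight u s - logWeight u c| ≤ 1 := by
  have h1 : |logWeight u (c + 1) - logWeight u c| < 1 := by
    simpa using hu.abs_logWeight_sub_lt (s := c + 1) (s' := c) (by linarith)
  have h2 : |logWeight u (c - 1) - logWeight u c| < 1 := by
    simpa using hu.abs_logWeight_sub_lt (s := c - 1) (s' := c) (by linarith)
  refine ⟨min (1 - |logWeight u (c + 1) - logWeight u c|) (1 - |logWeight u (c - 1) - logWeight u c|),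
    lt_min (by linarith) (by linarith), fun s hs => ?_⟩
  have m1 := min_le_left (1 - |logWeight u (c + 1) - logWeight u c|)
    (1 - |logWeight u (c - 1) - logWeight u c|)
  have m2 := min_le_right (1 - |logWeight u (c + 1) - logWeight u c|)
    (1 - |logWeight u (c - 1) - logWeight u c|)
  set η := min (1 - |logWeight u (c + 1) - logWeight u c|)
    (1 - |logWeight u (c - 1) - logWeight u c|)
  rw [abs_le] at hs
  rcases le_or_gt |s - c| 1 with h | h
  · exact (hu.abs_logWeight_sub_le s c).trans h
  · rcases lt_abs.mp h with h | h
    · have a := hu.abs_logWeight_sub_le s (c + 1)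
      rw [abs_of_nonneg (by linarith : 0 ≤ s - (c + 1))] at a
      have := abs_sub_le (logWeight u s) (logWeight u (c + 1)) (logWeight u c)
      linarith
    · have a := hu.abs_logWeight_sub_le s (c - 1)
      rw [abs_of_nonpos (by linarith : s - (c - 1) ≤ 0)] at a
      have := abs_sub_le (logWeight u s) (logWeight u (c - 1)) (logWeight u c)
      linarith

/-! ### Weighted scatter matrices and leverages -/

section Scatter

variable {n p : ℕ}

/-- The weighted scatter matrix `∑ᵢ wᵢ xᵢ xᵢᵀ`. -/
noncomputable def scatter (x : Fin n → EuclideanSpace ℝ (Fin p)) (w : Fin n → ℝ) :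
    Matrix (Fin p) (Fin p) ℝ :=
  ∑ i, w i • outer (x i)

/-- The bilinear leverage `xⱼᵀ S⁻¹ xᵢ` for the weighted scatter matrix `S`. -/
noncomputable def cross (x : Fin n → EuclideanSpace ℝ (Fin p)) (w : Fin n → ℝ) (i j : Fin n) : ℝ :=
  (x j).ofLp ⬝ᵥ (scatter x w)⁻¹.mulVec (x i).ofLp

/-- The leverage `xᵢᵀ S⁻¹ xᵢ` for the weighted scatter matrix `S`. -/
noncomputable def lev (x : Fin n → EuclideanSpace ℝ (Fin p)) (w : Fin n → ℝ) (i : Fin n) : ℝ :=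
  quad (scatter x w)⁻¹ (x i)

variable {x : Fin n → EuclideanSpace ℝ (Fin p)} {w w' : Fin n → ℝ}

theorem dotProduct_outer_mulVec (z : EuclideanSpace ℝ (Fin p)) (a b : Fin p → ℝ) :
    a ⬝ᵥ (outer z).mulVec b = (z.ofLp ⬝ᵥ a) * (z.ofLp ⬝ᵥ b) := by
  rw [outer, Matrix.vecMulVec_mulVec, dotProduct_comm a]
  simp [mul_comm]

theorem dotProduct_scatter_mulVec (a b : Fin p → ℝ) :
    a ⬝ᵥ (scatter x w).mulVec b = ∑ j, w j * (((x j).ofLp ⬝ᵥ a) * ((x j).ofLp ⬝ᵥ b)) := by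
  simp_rw [scatter, Matrix.sum_mulVec, Matrix.smul_mulVec, dotProduct_sum, dotProduct_smul,
    dotProduct_outer_mulVec, smul_eq_mul]

theorem scatter_isHermitian : (scatter x w).IsHermitian := by
  ext a b
  simp [scatter, outer, Matrix.sum_apply, Matrix.vecMulVec_apply, mul_comm]

theorem scatter_posDef (hS : (scatter x 1).PosDef) (hw : ∀ i, 0 < w i) : (scatter x w).PosDef := by
  refine Matrix.PosDef.of_dotProduct_mulVec_pos scatter_isHermitian fun {v} hv => ?_
  have h := hS.dotProduct_mulVec_pos hv
  rw [star_trivial, dotProduct_scatter_mulVec] at h ⊢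
  obtain ⟨j, -, hj⟩ := Finset.exists_lt_of_sum_lt (s := Finset.univ) (f := fun _ : Fin n => (0 : ℝ))
    (by simpa using h)
  refine Finset.sum_pos' (fun i _ => mul_nonneg (hw i).le (mul_self_nonneg _)) ⟨j, Finset.mem_univ _, ?_⟩
  exact mul_pos (hw j) (by simpa using hj)

theorem lev_eq_cross (i : Fin n) : lev x w i = cross x w i i := rfl

/-- Insert `S S⁻¹ = 1` and expand `S` as a sum. All leverage comparisons below are this expansion
followed by Cauchy–Schwarz. -/
theorem dotProduct_eq_sum_cross (hS : (scatter x w).PosDef) (a : Fin p → ℝ) (i : Fin n) :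
    (x i).ofLp ⬝ᵥ a = ∑ j, w j * (((x j).ofLp ⬝ᵥ a) * cross x w i j) := by
  have := dotProduct_scatter_mulVec (x := x) (w := w) a ((scatter x w)⁻¹.mulVec (x i).ofLp)
  rw [Matrix.mulVec_mulVec, Matrix.mul_nonsing_inv _ ((Matrix.isUnit_iff_isUnit_det _).mp hS.isUnit), Matrix.one_mulVec,
    dotProduct_comm] at this
  exact this

theorem cross_eq_sum (hS : (scatter x w).PosDef) (i k : Fin n) :
    cross x w' k i = ∑ j, w j * (cross x w' k j * cross x w i j) :=
  dotProduct_eq_sum_cross hS _ i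

theorem lev_nonneg (hS : (scatter x 1).PosDef) (hw : ∀ i, 0 < w i) (i : Fin n) : 0 ≤ lev x w i := by
  rw [lev_eq_cross, cross_eq_sum (scatter_posDef hS hw) i i]
  exact Finset.sum_nonneg fun j _ => mul_nonneg (hw j).le (mul_self_nonneg _)

/-- This is antitonicity of the matrix inverse, obtained by expanding `lev x w i` through `S(w')`:
its square is at most `(l * lev x w i) * lev x w' i`. -/
theorem lev_le_of_le (hS : (scatter x 1).PosDef) (hw : ∀ i, 0 < w i) (hw' : ∀ i, 0 < w' i)
    {l : ℝ} (hl : ∀ i, w' i ≤ l * w i) (i : Fin n) : lev x w i ≤ l * lev x w' i := by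
  have h0 := lev_nonneg hS hw i
  have h0' := lev_nonneg hS hw' i
  have h1 : lev x w i ^ 2 ≤ (∑ j, w' j * cross x w i j ^ 2) * (∑ j, w' j * cross x w' i j ^ 2) := by
    rw [lev_eq_cross, cross_eq_sum (scatter_posDef hS hw') i i]
    refine Finset.sum_sq_le_sum_mul_sum_of_sq_le_mul _
      (fun j _ => mul_nonneg (hw' j).le (sq_nonneg _))
      (fun j _ => mul_nonneg (hw' j).le (sq_nonneg _)) fun j _ => le_of_eq (by ring)
  have h2 : (∑ j, w' j * cross x w' i j ^ 2) = lev x w' i := by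
    rw [lev_eq_cross, cross_eq_sum (scatter_posDef hS hw') i i]
    exact Finset.sum_congr rfl fun j _ => by ring
  have h3 : (∑ j, w' j * cross x w i j ^ 2) ≤ l * lev x w i := by
    rw [lev_eq_cross, cross_eq_sum (scatter_posDef hS hw) i i, Finset.mul_sum]
    refine Finset.sum_le_sum fun j _ => ?_
    have := mul_le_mul_of_nonneg_right (hl j) (sq_nonneg (cross x w i j))
    linarith
  rw [h2] at h1
  rcases h0.eq_or_lt with h | h
  · rw [← h]
    have hl0 : 0 < l := by
      have := (hw' i).trans_le (hl i)
      exact pos_of_mul_pos_left this (hw i).le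
    positivity
  · have := h1.trans (mul_le_mul_of_nonneg_right h3 h0')
    nlinarith

/-- With `sq_lev_one_le`, this bounds weighted leverages on both sides by averages of `1 / w` and
`w` against the squared hat-matrix row. Unlike `lev_le_of_le`, these bounds see where the weights
are large or small. -/
theorem lev_le_sum_div (hS : (scatter x 1).PosDef) (hw : ∀ i, 0 < w i) (i : Fin n) :
    lev x w i ≤ ∑ j, cross x 1 i j ^ 2 / w j := by
  have h0 := lev_nonneg hS hw i
  have h1 : lev x w i ^ 2 ≤ (∑ j, cross x 1 i j ^ 2 / w j) * (∑ j, w j * cross x w i j ^ 2) := by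
    rw [lev_eq_cross, cross_eq_sum hS i i]
    refine Finset.sum_sq_le_sum_mul_sum_of_sq_le_mul _
      (fun j _ => div_nonneg (sq_nonneg _) (hw j).le)
      (fun j _ => mul_nonneg (hw j).le (sq_nonneg _)) fun j _ => le_of_eq ?_
    have := (hw j).ne'
    simp only [Pi.one_apply]
    field_simp
  have h2 : (∑ j, w j * cross x w i j ^ 2) = lev x w i := by
    rw [lev_eq_cross, cross_eq_sum (scatter_posDef hS hw) i i]
    exact Finset.sum_congr rfl fun j _ => by ring
  rw [h2] at h1
  rcases h0.eq_or_lt with h | h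
  · rw [← h]
    exact Finset.sum_nonneg fun j _ => div_nonneg (sq_nonneg _) (hw j).le
  · nlinarith

theorem sq_lev_one_le (hS : (scatter x 1).PosDef) (hw : ∀ i, 0 < w i) (i : Fin n) :
    lev x 1 i ^ 2 ≤ (∑ j, w j * cross x 1 i j ^ 2) * lev x w i := by
  have h2 : (∑ j, w j * cross x w i j ^ 2) = lev x w i := by
    rw [lev_eq_cross, cross_eq_sum (scatter_posDef hS hw) i i]
    exact Finset.sum_congr rfl fun j _ => by ring
  rw [← h2]
  rw [lev_eq_cross, cross_eq_sum (scatter_posDef hS hw) i i]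
  refine Finset.sum_sq_le_sum_mul_sum_of_sq_le_mul _
    (fun j _ => mul_nonneg (hw j).le (sq_nonneg _))
    (fun j _ => mul_nonneg (hw j).le (sq_nonneg _)) fun j _ => le_of_eq (by ring)

theorem sum_cross_sq (hS : (scatter x 1).PosDef) (i : Fin n) :
    ∑ j, cross x 1 i j ^ 2 = lev x 1 i := by
  rw [lev_eq_cross, cross_eq_sum hS i i]
  exact Finset.sum_congr rfl fun j _ => by simp; ring

/-- The trace of `S S⁻¹ = 1`. -/
theorem sum_mul_lev (hS : (scatter x w).PosDef) : ∑ i, w i * lev x w i = p := by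
  have h : ∀ i, w i * lev x w i = ((w i • outer (x i)) * (scatter x w)⁻¹).trace := by
    intro i
    rw [Matrix.smul_mul, Matrix.trace_smul, smul_eq_mul, outer, Matrix.vecMulVec_mul,
      Matrix.trace_vecMulVec, dotProduct_comm]
    simp [lev, quad, Matrix.dotProduct_mulVec]
  simp_rw [h]
  rw [← Matrix.trace_sum, ← Finset.sum_mul, ← scatter, Matrix.mul_nonsing_inv _ ((Matrix.isUnit_iff_isUnit_det _).mp hS.isUnit)]
  simp

theorem isMEstimator_iff_exists (hS : (scatter x 1).PosDef) {u : ℝ → ℝ}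
    (hu : ∀ t, 0 ≤ t → 0 < u t) {S : Matrix (Fin p) (Fin p) ℝ} :
    IsMEstimator u x S ↔
      ∃ w : Fin n → ℝ, (∀ i, 0 < w i) ∧ (∀ i, w i = u (lev x w i)) ∧ S = scatter x w := by
  constructor
  · rintro ⟨hpos, hS⟩
    have h : S = scatter x fun i => u (quad S⁻¹ (x i)) := hS
    refine ⟨fun i => u (quad S⁻¹ (x i)), fun i => hu _ ?_, fun i => ?_, hS⟩
    · simpa [quad] using hpos.inv.posSemidef.dotProduct_mulVec_nonneg (x i).ofLp
    · rw [lev, ← h]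
  · rintro ⟨w, hw, hfix, rfl⟩
    refine ⟨scatter_posDef hS hw, ?_⟩
    conv_lhs => rw [scatter]
    refine Finset.sum_congr rfl fun i _ => ?_
    rw [hfix i]
    rfl

end Scatter

/-! ### Existence and uniqueness of the weights -/

theorem psiInv_pos {u : ℝ → ℝ} {y : ℝ} (hy : 0 < y) (hu : WeightAssumptions u y) :
    0 < psiInv u y := by
  obtain ⟨h0, h1, -⟩ := psiInv_spec hy hu
  refine h0.lt_of_ne fun h => ?_
  rw [← h] at h1
  simp [psi] at h1
  exact hy.ne h1

theorem abs_log_sub_log_le {h y ε : ℝ} (hy : 0 < y) (hε : ε ≤ y / 2) (hh : |h - y| ≤ ε) :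
    |Real.log h - Real.log y| ≤ 2 * ε / y := by
  rw [abs_le] at hh
  have h0 : 0 < h := by linarith
  have hε0 : 0 ≤ ε := by linarith
  have e1 := Real.log_le_sub_one_of_pos (div_pos h0 hy)
  have e2 := Real.log_le_sub_one_of_pos (div_pos hy h0)
  rw [Real.log_div h0.ne' hy.ne'] at e1
  rw [Real.log_div hy.ne' h0.ne'] at e2
  have f1 : h / y - 1 ≤ 2 * ε / y := by
    rw [div_sub_one hy.ne']
    gcongr
    linarith
  have f2 : y / h - 1 ≤ 2 * ε / y := by
    rw [div_sub_one h0.ne', div_le_div_iff₀ h0 hy]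
    nlinarith
  rw [abs_le]
  constructor <;> linarith

section Scatter

variable {n p : ℕ} {x : Fin n → EuclideanSpace ℝ (Fin p)} {w w' : Fin n → ℝ}

theorem lev_pos (hS : (scatter x 1).PosDef) (hw : ∀ i, 0 < w i) {i : Fin n}
    (hi : 0 < lev x 1 i) : 0 < lev x w i := by
  refine (lev_nonneg hS hw i).lt_of_ne fun h => ?_
  have := sq_lev_one_le hS hw i
  rw [← h, mul_zero] at this
  nlinarith

/-- An antitone map homogeneous of degree -1 is nonexpansive for the sup distance of logarithms; the
factor `exp d` in `lev_le_of_le` expresses both properties at once. -/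
theorem log_lev_sub_le (hS : (scatter x 1).PosDef) (hw : ∀ i, 0 < w i) (hw' : ∀ i, 0 < w' i)
    {i : Fin n} (hi : 0 < lev x 1 i) {d : ℝ}
    (hd : ∀ j, |Real.log (w j) - Real.log (w' j)| ≤ d) :
    |Real.log (lev x w i) - Real.log (lev x w' i)| ≤ d := by
  have key : ∀ v v' : Fin n → ℝ, (∀ i, 0 < v i) → (∀ i, 0 < v' i) →
      (∀ j, |Real.log (v j) - Real.log (v' j)| ≤ d) →
      Real.log (lev x v i) - Real.log (lev x v' i) ≤ d := by
    intro v v' hv hv' h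
    have h1 : lev x v i ≤ Real.exp d * lev x v' i := by
      refine lev_le_of_le hS hv hv' (fun j => ?_) i
      rw [← Real.log_le_log_iff (hv' j) (mul_pos (Real.exp_pos _) (hv j)),
        Real.log_mul (Real.exp_pos _).ne' (hv j).ne', Real.log_exp]
      have := (abs_le.mp (h j)).1
      linarith
    have h2 := Real.log_le_log (lev_pos hS hv hi) h1
    rw [Real.log_mul (Real.exp_pos _).ne' (lev_pos hS hv' hi).ne', Real.log_exp] at h2
    linarith
  rw [abs_le]
  constructor
  · have := key w' w hw' hw fun j => by rw [abs_sub_comm]; exact hd j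
    linarith
  · exact key w w' hw hw' hd

theorem lev_const (hS : (scatter x 1).PosDef) {k : ℝ} (hk : 0 < k) (i : Fin n) :
    lev x (fun _ => k) i = lev x 1 i / k := by
  apply le_antisymm
  · have := lev_le_of_le hS (w := fun _ => k) (w' := 1) (l := 1 / k) (fun _ => hk)
      (fun _ => one_pos) (fun _ => by simp [hk.ne']) i
    rwa [one_div_mul_eq_div] at this
  · have := lev_le_of_le hS (w := 1) (w' := fun _ => k) (l := k) (fun _ => one_pos) (fun _ => hk)
      (fun _ => by simp) i
    rwa [div_le_iff₀' hk]

theorem existsUnique_weights {y : ℝ} (hy : 0 < y) {u : ℝ → ℝ} (hu : WeightAssumptions u y) :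
    ∃ η, 0 < η ∧ ∀ (n p : ℕ) (x : Fin n → EuclideanSpace ℝ (Fin p)), (scatter x 1).PosDef →
      (∀ i, |lev x 1 i - y| ≤ η) →
      ∃! w : Fin n → ℝ, (∀ i, 0 < w i) ∧ ∀ i, w i = u (lev x w i) := by
  obtain ⟨ht0, hty, -⟩ := psiInv_spec hy hu
  have ht := psiInv_pos hy hu
  set t := psiInv u y
  have hut : 0 < u t := hu.pos t ht0
  obtain ⟨η, hη, hmargin⟩ := hu.exists_margin (Real.log t)
  -- By `abs_log_sub_log_le`, a deviation `η * y / 2` from `y` moves the logarithm by at most `η`.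
  refine ⟨min (y / 2) (η * y / 2), lt_min (by positivity) (by positivity), fun n p x hS hlev => ?_⟩
  have hpos : ∀ i, 0 < lev x 1 i := fun i => by
    have := (abs_le.mp ((hlev i).trans (min_le_left _ _))).1
    linarith
  have hlog : ∀ i, |Real.log (lev x 1 i) - Real.log y| ≤ η := fun i => by
    refine (abs_log_sub_log_le hy (min_le_left _ _) (hlev i)).trans ?_
    rw [div_le_iff₀ hy]
    have := min_le_right (y / 2) (η * y / 2)
    linarith
  let W : (Fin n → ℝ) → Fin n → ℝ := fun a i => Real.exp (a i)
  have hW : ∀ a i, 0 < W a i := fun a i => Real.exp_pos _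
  let Φ : (Fin n → ℝ) → Fin n → ℝ := fun a i => logWeight u (Real.log (lev x (W a) i))
  have hΦ : ∀ a i, Real.exp (Φ a i) = u (lev x (W a) i) := fun a i => by
    have := lev_pos hS (hW a) (hpos i)
    simp only [Φ, logWeight]
    rw [Real.exp_log this, Real.exp_log (hu.pos _ this.le)]
  have hcontr : ∀ a b, a ≠ b → dist (Φ a) (Φ b) < dist a b := by
    intro a b hab
    have h0 : 0 < dist a b := dist_pos.mpr hab
    rw [dist_pi_lt_iff h0]
    intro i
    have h1 : |Real.log (lev x (W a) i) - Real.log (lev x (W b) i)| ≤ dist a b :=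
      log_lev_sub_le hS (hW a) (hW b) (hpos i) fun j => by
        simpa [W, Real.dist_eq] using dist_le_pi_dist a b j
    rw [Real.dist_eq]
    rcases eq_or_ne (Real.log (lev x (W a) i)) (Real.log (lev x (W b) i)) with h | h
    · simpa [Φ, h] using h0
    · exact (hu.abs_logWeight_sub_lt h).trans_le h1
  have hmaps : Set.MapsTo Φ (Metric.closedBall (fun _ => Real.log (u t)) 1)
      (Metric.closedBall (fun _ => Real.log (u t)) 1) := by
    intro a ha
    rw [Metric.mem_closedBall, dist_pi_le_iff zero_le_one] at ha ⊢
    intro i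
    have h1 : |Real.log (lev x (W a) i) - Real.log (lev x (fun _ => u t) i)| ≤ 1 :=
      log_lev_sub_le hS (hW a) (fun _ => hut) (hpos i) fun j => by
        simpa [W, Real.dist_eq] using ha j
    -- At the constant weight `u t` the leverage is `hᵢ / u t`, which would be exactly `t` if `hᵢ =
    -- y = t * u t`.
    have h2 : Real.log (lev x (fun _ => u t) i) - Real.log t =
        Real.log (lev x 1 i) - Real.log y := by
      rw [lev_const hS hut, ← hty, psi, Real.log_mul ht.ne' hut.ne',
        Real.log_div (hpos i).ne' hut.ne']
      ring
    have h3 : Real.log (u t) = logWeight u (Real.log t) := by rw [logWeight, Real.exp_log ht]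
    rw [Real.dist_eq, h3]
    apply hmargin
    have h4 := hlog i
    rw [← h2] at h4
    have := abs_sub_le (Real.log (lev x (W a) i)) (Real.log (lev x (fun _ => u t) i)) (Real.log t)
    linarith
  obtain ⟨a, -, ha⟩ := exists_isFixedPt_of_dist_lt (isCompact_closedBall _ _)
    (Metric.nonempty_closedBall.mpr zero_le_one) hmaps hcontr
  refine ⟨W a, ⟨hW a, fun i => ?_⟩, fun w ⟨hw, hfix⟩ => ?_⟩
  · rw [← hΦ a i, ha]
  · have hWl : W (fun i => Real.log (w i)) = w := funext fun i => Real.exp_log (hw i)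
    have hb : Φ (fun i => Real.log (w i)) = fun i => Real.log (w i) := by
      funext i
      rw [← Real.exp_eq_exp, hΦ, hWl, Real.exp_log (hw i), ← hfix i]
    rw [← hWl]
    congr 1
    by_contra hne
    have := hcontr _ _ hne
    rw [ha, hb] at this
    exact lt_irrefl _ this

/-! ### Quantitative contraction from mixing -/

/-- Any two rows of the squared hat matrix share a fixed proportion of their mass. -/
def Mixing (x : Fin n → EuclideanSpace ℝ (Fin p)) (c : ℝ) : Prop :=
  ∀ i k, ∃ J : Finset (Fin n), (n : ℝ) / 2 ≤ J.card ∧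
    ∀ j ∈ J, c / n ≤ cross x 1 i j ^ 2 ∧ c / n ≤ cross x 1 k j ^ 2

/-- The crude bound on the ratio is `M / m` times the unweighted one, and near equality would force
`w ≈ m` on the mass of row `i` and `w ≈ M` on the mass of row `k`. The shared set `J` rules out both
at once unless `m ≈ M`. -/
theorem lev_ratio_le (hS : (scatter x 1).PosDef) (hw : ∀ i, 0 < w i) {c : ℝ} (hc : 0 < c)
    (hn : 0 < n) (hx : Mixing x c) {m M : ℝ} (hm : 0 < m) (hmw : ∀ i, m ≤ w i)
    (hwM : ∀ i, w i ≤ M) (hpos : ∀ i, 0 < lev x 1 i) (hle : ∀ i, lev x 1 i ≤ 1) (i k : Fin n) :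
    lev x w i / lev x w k ≤
      (M / m) * (lev x 1 i / lev x 1 k) * (1 - c / 4 * (1 - m / M)) := by
  have hmM : m ≤ M := (hmw i).trans (hwM i)
  have hM : 0 < M := hm.trans_le hmM
  have hn' : (0 : ℝ) < n := by exact_mod_cast hn
  obtain ⟨J, hJ, hJc⟩ := hx i k
  have hposi := hpos i
  have hposk := hpos k
  -- The row has total mass `lev x 1 l ≤ 1`, so an absolute loss of mass is also at least that
  -- relative loss.
  have defect : ∀ (l : Fin n) (f : Fin n → ℝ), (∀ j, f j ≤ 1) →
      (∀ j ∈ J, c / n ≤ cross x 1 l j ^ 2) →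
      ∑ j, cross x 1 l j ^ 2 * f j ≤ lev x 1 l * (1 - c / n * ∑ j ∈ J, (1 - f j)) := by
    intro l f hf hl
    have h1 : c / n * ∑ j ∈ J, (1 - f j) ≤ ∑ j, cross x 1 l j ^ 2 * (1 - f j) := by
      rw [Finset.mul_sum]
      refine (Finset.sum_le_sum fun j hj =>
        mul_le_mul_of_nonneg_right (hl j hj) (sub_nonneg.mpr (hf j))).trans ?_
      exact Finset.sum_le_univ_sum_of_nonneg fun j =>
        mul_nonneg (sq_nonneg _) (sub_nonneg.mpr (hf j))
    have h2 : ∑ j, cross x 1 l j ^ 2 * (1 - f j) =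
        lev x 1 l - ∑ j, cross x 1 l j ^ 2 * f j := by
      simp_rw [mul_sub, mul_one, Finset.sum_sub_distrib, sum_cross_sq hS]
    have h3 : 0 ≤ c / n * ∑ j ∈ J, (1 - f j) :=
      mul_nonneg (by positivity) (Finset.sum_nonneg fun j _ => sub_nonneg.mpr (hf j))
    have := mul_le_mul_of_nonneg_right (hle l) h3
    nlinarith
  have hA := defect i (fun j => m / w j) (fun j => (div_le_one (hw j)).mpr (hmw j))
    fun j hj => (hJc j hj).1
  have hB := defect k (fun j => w j / M) (fun j => (div_le_one hM).mpr (hwM j))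
    fun j hj => (hJc j hj).2
  set a := c / n * ∑ j ∈ J, (1 - m / w j)
  set b := c / n * ∑ j ∈ J, (1 - w j / M)
  have ha0 : 0 ≤ a := mul_nonneg (by positivity)
    (Finset.sum_nonneg fun j _ => sub_nonneg.mpr ((div_le_one (hw j)).mpr (hmw j)))
  have hb0 : 0 ≤ b := mul_nonneg (by positivity)
    (Finset.sum_nonneg fun j _ => sub_nonneg.mpr ((div_le_one hM).mpr (hwM j)))
  have hab : c / 2 * (1 - m / M) ≤ a + b := by
    rw [← mul_add, ← Finset.sum_add_distrib]
    -- Each weight is far from `m` or far from `M`: expand `(1 - m/w)(1 - w/M) ≥ 0`.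
    have h1 : ∀ j ∈ J, 1 - m / M ≤ (1 - m / w j) + (1 - w j / M) := by
      intro j _
      have h2 : 0 ≤ (1 - m / w j) * (1 - w j / M) :=
        mul_nonneg (sub_nonneg.mpr ((div_le_one (hw j)).mpr (hmw j)))
          (sub_nonneg.mpr ((div_le_one hM).mpr (hwM j)))
      have h3 : m / w j * (w j / M) = m / M := by
        have := (hw j).ne'
        field_simp
      nlinarith
    have h2 := Finset.sum_le_sum h1
    rw [Finset.sum_const, nsmul_eq_mul] at h2
    have h3 : 0 ≤ 1 - m / M := sub_nonneg.mpr ((div_le_one hM).mpr hmM)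
    calc c / 2 * (1 - m / M) = c / n * ((n / 2) * (1 - m / M)) := by field_simp
      _ ≤ c / n * (J.card * (1 - m / M)) := by gcongr
      _ ≤ _ := by gcongr
  have hA0 : 0 ≤ ∑ j, cross x 1 i j ^ 2 * (m / w j) :=
    Finset.sum_nonneg fun j _ => mul_nonneg (sq_nonneg _) (div_pos hm (hw j)).le
  have hB0 : 0 ≤ ∑ j, cross x 1 k j ^ 2 * (w j / M) :=
    Finset.sum_nonneg fun j _ => mul_nonneg (sq_nonneg _) (div_pos (hw j) hM).le
  have ha1 : 0 ≤ 1 - a := by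
    by_contra h
    push Not at h
    have := mul_neg_of_pos_of_neg hposi h
    linarith
  have hb1 : 0 ≤ 1 - b := by
    by_contra h
    push Not at h
    have := mul_neg_of_pos_of_neg hposk h
    linarith
  -- For `a, b ∈ [0, 1]`, `ab ≤ (a + b)/2`, hence `(1 - a)(1 - b) ≤ 1 - (a + b)/2`.
  have hprod : (1 - a) * (1 - b) ≤ 1 - c / 4 * (1 - m / M) := by
    nlinarith [mul_nonneg ha0 hb1, mul_nonneg hb0 ha1]
  have e1 : lev x w i ≤ (∑ j, cross x 1 i j ^ 2 * (m / w j)) / m := by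
    refine (lev_le_sum_div hS hw i).trans_eq ?_
    rw [Finset.sum_div]
    refine Finset.sum_congr rfl fun j _ => ?_
    field_simp
  have e2 : lev x 1 k ^ 2 ≤ M * (∑ j, cross x 1 k j ^ 2 * (w j / M)) * lev x w k := by
    refine (sq_lev_one_le hS hw k).trans_eq ?_
    rw [Finset.mul_sum]
    congr 1
    refine Finset.sum_congr rfl fun j _ => ?_
    field_simp
  have hk := lev_pos hS hw (hposk)
  have e3 : lev x w i ≤ lev x 1 i * (1 - a) / m := e1.trans (by gcongr)
  have e4 : lev x 1 k ≤ M * (1 - b) * lev x w k := by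
    have : lev x 1 k ^ 2 ≤ M * (lev x 1 k * (1 - b)) * lev x w k := e2.trans (by gcongr)
    have : lev x 1 k * lev x 1 k ≤ lev x 1 k * (M * (1 - b) * lev x w k) := by linarith
    exact le_of_mul_le_mul_left this hposk
  rw [div_le_iff₀ hk]
  calc lev x w i ≤ lev x 1 i * (1 - a) / m := e3
    _ = lev x 1 i * (1 - a) / m / lev x 1 k * lev x 1 k := by field_simp
    _ ≤ lev x 1 i * (1 - a) / m / lev x 1 k * (M * (1 - b) * lev x w k) := by gcongr
    _ = M / m * (lev x 1 i / lev x 1 k) * ((1 - a) * (1 - b)) * lev x w k := by field_simp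
    _ ≤ _ := by gcongr

end Scatter

section Scatter

variable {n p : ℕ} {x : Fin n → EuclideanSpace ℝ (Fin p)} {w : Fin n → ℝ}

/-- Since `u` does not increase logarithmic distances, the spread of the weights is at most that of
the leverages, which by `lev_ratio_le` is at most the same spread plus `r` minus a gain. Cancelling
the spread bounds the gain by `r`. -/
theorem log_weight_spread_le {u : ℝ → ℝ} {y : ℝ} (hu : WeightAssumptions u y)
    (hS : (scatter x 1).PosDef) (hw : ∀ i, 0 < w i) (hfix : ∀ i, w i = u (lev x w i)) {c : ℝ}
    (hc : 0 < c) (hn : 0 < n) (hx : Mixing x c) (hle : ∀ i, lev x 1 i ≤ 1)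
    (hpos : ∀ i, 0 < lev x 1 i) {r : ℝ}
    (hr : ∀ i k, Real.log (lev x 1 i) - Real.log (lev x 1 k) ≤ r) (hrc : r ≤ c / 8) (i k : Fin n) :
    Real.log (lev x w i) - Real.log (lev x w k) ≤ r + 8 * r / c := by
  have : Nonempty (Fin n) := ⟨i⟩
  obtain ⟨a, ha⟩ := Finite.exists_max w
  obtain ⟨b, hb⟩ := Finite.exists_min w
  have hL : ∀ i, 0 < lev x w i := fun i => lev_pos hS hw (hpos i)
  have hq0 : 0 < w b / w a := div_pos (hw b) (hw a)
  have hq1 : w b / w a ≤ 1 := (div_le_one (hw a)).mpr (hb a)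
  have ratio : ∀ i k, 0 < 1 - c / 4 * (1 - w b / w a) ∧
      Real.log (lev x w i) - Real.log (lev x w k) ≤
      Real.log (w a) - Real.log (w b) + r + Real.log (1 - c / 4 * (1 - w b / w a)) := by
    intro i k
    have h := lev_ratio_le hS hw hc hn hx (hw b) hb ha hpos hle i k
    have h0 : 0 < lev x w i / lev x w k := div_pos (hL i) (hL k)
    have h1 : 0 < w a / w b * (lev x 1 i / lev x 1 k) :=
      mul_pos (div_pos (hw a) (hw b)) (div_pos (hpos i) (hpos k))
    have h2 : 0 < 1 - c / 4 * (1 - w b / w a) := pos_of_mul_pos_right (h0.trans_le h) h1.le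
    refine ⟨h2, ?_⟩
    have h3 := Real.log_le_log h0 h
    rw [Real.log_mul h1.ne' h2.ne', Real.log_mul (div_pos (hw a) (hw b)).ne'
      (div_pos (hpos i) (hpos k)).ne', Real.log_div (hL i).ne' (hL k).ne',
      Real.log_div (hw a).ne' (hw b).ne', Real.log_div (hpos i).ne' (hpos k).ne'] at h3
    linarith [hr i k]
  have hlog : Real.log (w a) - Real.log (w b) ≤
      |Real.log (lev x w a) - Real.log (lev x w b)| := by
    have h := hu.abs_logWeight_sub_le (Real.log (lev x w a)) (Real.log (lev x w b))
    simp only [logWeight, Real.exp_log (hL _), ← hfix] at h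
    exact (le_abs_self _).trans h
  have h1 : Real.log (w a) - Real.log (w b) ≤
      Real.log (w a) - Real.log (w b) + r + Real.log (1 - c / 4 * (1 - w b / w a)) := by
    refine hlog.trans (abs_le.mpr ⟨?_, (ratio a b).2⟩)
    have := (ratio b a).2
    linarith
  have h2 := Real.log_le_sub_one_of_pos (ratio i k).1
  have h3 : 1 - w b / w a ≤ 4 * r / c := by
    rw [le_div_iff₀ hc]
    linarith
  -- The hypothesis `r ≤ c / 8` keeps the extreme weights within a factor 2, so that the logarithm
  -- is linearised at the cost of a factor 2.
  have h4 : 1 / 2 ≤ w b / w a := by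
    have : 4 * r / c ≤ 1 / 2 := by
      rw [div_le_iff₀ hc]
      linarith
    linarith
  have h5 : Real.log (w a) - Real.log (w b) ≤ 8 * r / c := by
    rw [← Real.log_div (hw a).ne' (hw b).ne']
    refine (Real.log_le_sub_one_of_pos (div_pos (hw a) (hw b))).trans ?_
    have h6 : w a / w b - 1 = (1 - w b / w a) * (w a / w b) := by
      have := (hw a).ne'
      have := (hw b).ne'
      field_simp
    have h7 : w a / w b ≤ 2 := by
      rw [div_le_iff₀ (hw b)]
      rw [le_div_iff₀ (hw a)] at h4
      linarith
    rw [h6]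
    calc (1 - w b / w a) * (w a / w b) ≤ (1 - w b / w a) * 2 :=
          mul_le_mul_of_nonneg_left h7 (sub_nonneg.mpr hq1)
      _ ≤ 4 * r / c * 2 := by linarith
      _ = 8 * r / c := by ring
  have h8 := (ratio i k).2
  have h9 : Real.log (1 - c / 4 * (1 - w b / w a)) ≤ 0 := by
    have : 0 ≤ c / 4 * (1 - w b / w a) := mul_nonneg (by positivity) (sub_nonneg.mpr hq1)
    linarith
  linarith

end Scatter

/-- Continuity of `ψ⁻¹` at `y`. There is no rate, as the derivative of `ψ` may vanish at `ψ⁻¹(y)`;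
this is one reason why the final `δ` is not explicit in `ε`. -/
theorem exists_psi_margin {u : ℝ → ℝ} {y : ℝ} (hy : 0 < y) (hu : WeightAssumptions u y) {ε : ℝ}
    (hε : 0 < ε) :
    ∃ δ, 0 < δ ∧ (∀ t, 0 < t → psi u t < y + δ → Real.log t < Real.log (psiInv u y) + ε) ∧
      ∀ t, 0 < t → y - δ < psi u t → Real.log (psiInv u y) - ε < Real.log t := by
  have ht := psiInv_pos hy hu
  obtain ⟨-, hty, -⟩ := psiInv_spec hy hu
  set t₀ := psiInv u y
  have e1 : 1 < Real.exp ε := Real.one_lt_exp_iff.mpr hε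
  have e2 : Real.exp (-ε) < 1 := Real.exp_lt_one_iff.mpr (by linarith)
  have p1 : 0 < t₀ * Real.exp ε := by positivity
  have p2 : 0 < t₀ * Real.exp (-ε) := by positivity
  have h1 : y < psi u (t₀ * Real.exp ε) := by
    rw [← hty]
    exact hu.psi_strictMono ht.le p1.le (by nlinarith)
  have h2 : psi u (t₀ * Real.exp (-ε)) < y := by
    rw [← hty]
    exact hu.psi_strictMono p2.le ht.le (by nlinarith)
  refine ⟨min (psi u (t₀ * Real.exp ε) - y) (y - psi u (t₀ * Real.exp (-ε))),
    lt_min (by linarith) (by linarith), fun t h0 h => ?_, fun t h0 h => ?_⟩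
  · have := min_le_left (psi u (t₀ * Real.exp ε) - y) (y - psi u (t₀ * Real.exp (-ε)))
    have h3 := (hu.psi_strictMono.lt_iff_lt h0.le p1.le).mp (by linarith)
    have := Real.log_lt_log h0 h3
    rwa [Real.log_mul ht.ne' (Real.exp_pos _).ne', Real.log_exp] at this
  · have := min_le_right (psi u (t₀ * Real.exp ε) - y) (y - psi u (t₀ * Real.exp (-ε)))
    have h3 := (hu.psi_strictMono.lt_iff_lt p2.le h0.le).mp (by linarith)
    have := Real.log_lt_log p2 h3
    rwa [Real.log_mul ht.ne' (Real.exp_pos _).ne', Real.log_exp] at this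

theorem exists_weights_close {y : ℝ} (hy0 : 0 < y) (hy1 : y < 1) {u : ℝ → ℝ}
    (hu : WeightAssumptions u y) {c : ℝ} (hc : 0 < c) :
    ∃ K η : ℝ, 0 < K ∧ 0 < η ∧ ∀ ε, 0 < ε → ε < η → ∃ δ, 0 < δ ∧
      ∀ n p : ℕ, 0 < n → |(p : ℝ) / n - y| < δ → ∀ x : Fin n → EuclideanSpace ℝ (Fin p),
        (scatter x 1).PosDef → (∀ i, |lev x 1 i - y| ≤ ε) → Mixing x c →
          ∀ w : Fin n → ℝ, (∀ i, 0 < w i) → (∀ i, w i = u (lev x w i)) →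
            ∀ i, |w i / u (psiInv u y) - 1| ≤ K * ε := by
  have ht := psiInv_pos hy0 hu
  set t := psiInv u y
  have hut := hu.pos t ht.le
  -- The term 1 is the error of the reference index from `exists_psi_margin`; the rest is the spread
  -- `r + 8 * r / c` with `r = 4 * ε / y`.
  set K₁ := 1 + (4 / y + 8 * (4 / y) / c) with hK₁
  have hK₁0 : 0 < K₁ := by positivity
  -- The four bounds on `ε` serve, in order, the logarithm estimate, leverages at most 1, `r ≤ c /
  -- 8`, and `K₁ * ε ≤ 1`, under which `|exp a - 1| ≤ 2 * |a|` applies.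
  refine ⟨2 * K₁, min (min (y / 2) (1 - y)) (min (c * y / 32) (1 / K₁)), by positivity,
    lt_min (lt_min (by positivity) (by linarith)) (lt_min (by positivity) (by positivity)),
    fun ε hε hεη => ?_⟩
  obtain ⟨δ, hδ, hup, hlow⟩ := exists_psi_margin hy0 hu hε
  refine ⟨δ, hδ, fun n p hn hp x hS hlev hx w hw hfix => ?_⟩
  simp only [lt_min_iff] at hεη
  obtain ⟨⟨hε1, hε2⟩, hε3, hε4⟩ := hεη
  have hlev' := fun i => abs_le.mp (hlev i)
  have hpos : ∀ i, 0 < lev x 1 i := fun i => by linarith [hlev' i]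
  have hle : ∀ i, lev x 1 i ≤ 1 := fun i => by linarith [hlev' i]
  have hL : ∀ i, 0 < lev x w i := fun i => lev_pos hS hw (hpos i)
  have hr : ∀ i k, Real.log (lev x 1 i) - Real.log (lev x 1 k) ≤ 4 * ε / y := by
    intro i k
    have h1 := (abs_le.mp (abs_log_sub_log_le hy0 hε1.le (hlev i))).2
    have h2 := (abs_le.mp (abs_log_sub_log_le hy0 hε1.le (hlev k))).1
    have : 4 * ε / y = 2 * ε / y + 2 * ε / y := by ring
    linarith
  have hspread := log_weight_spread_le hu hS hw hfix hc hn hx hle hpos hr (by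
    rw [div_le_iff₀ hy0]
    linarith)
  have hn' : (0 : ℝ) < n := by exact_mod_cast hn
  have hne : (Finset.univ : Finset (Fin n)).Nonempty := ⟨⟨0, hn⟩, Finset.mem_univ _⟩
  have hsum : ∑ i, w i * lev x w i = ∑ _i : Fin n, (p : ℝ) / n := by
    rw [sum_mul_lev (scatter_posDef hS hw), Finset.sum_const, Finset.card_univ, Fintype.card_fin,
      nsmul_eq_mul]
    field_simp
  -- The values `ψ (lev x w i) = w i * lev x w i` average to `p / n`, so one is at most and one at
  -- least `p / n`. The spread bound carries this to every index.
  obtain ⟨j, -, hj⟩ := Finset.exists_le_of_sum_le hne hsum.le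
  obtain ⟨k, -, hk⟩ := Finset.exists_le_of_sum_le hne hsum.ge
  rw [abs_lt] at hp
  have hpsi : ∀ i, psi u (lev x w i) = w i * lev x w i := fun i => by
    rw [psi, ← hfix i, mul_comm]
  have hj' := hup _ (hL j) (by rw [hpsi]; linarith)
  have hk' := hlow _ (hL k) (by rw [hpsi]; linarith)
  intro i
  have h1 := hspread i j
  have h2 := hspread k i
  have hK : K₁ * ε = ε + (4 * ε / y + 8 * (4 * ε / y) / c) := by rw [hK₁]; ring
  have hclose : |Real.log (lev x w i) - Real.log t| ≤ K₁ * ε := by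
    rw [abs_le]
    constructor <;> linarith
  have h3 := (hu.abs_logWeight_sub_le _ _).trans hclose
  simp only [logWeight, Real.exp_log (hL _), Real.exp_log ht, ← hfix] at h3
  rw [← Real.log_div (hw i).ne' hut.ne'] at h3
  have h4 : K₁ * ε ≤ 1 := by
    rw [lt_div_iff₀ hK₁0] at hε4
    linarith
  have h5 := Real.abs_exp_sub_one_le (h3.trans h4)
  rw [Real.exp_log (div_pos (hw i) hut)] at h5
  linarith

/-! ### From weights to the operator norm, and reduction to the identity covariance -/

section Scatter

variable {n p : ℕ} {x : Fin n → EuclideanSpace ℝ (Fin p)} {w : Fin n → ℝ}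

theorem opNorm_le_of_dotProduct {M : Matrix (Fin p) (Fin p) ℝ} {C : ℝ} (hC : 0 ≤ C)
    (h : ∀ a b : EuclideanSpace ℝ (Fin p), |a.ofLp ⬝ᵥ M.mulVec b.ofLp| ≤ C * (‖a‖ * ‖b‖)) :
    opNorm M ≤ C := by
  refine ContinuousLinearMap.opNorm_le_bound _ hC fun b => ?_
  set z := Matrix.toEuclideanCLM (n := Fin p) (𝕜 := ℝ) M b with hz
  have h1 := h z b
  rw [← Matrix.inner_toEuclideanCLM, ← hz, real_inner_self_eq_norm_sq] at h1
  have h2 := (le_abs_self _).trans h1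
  rcases (norm_nonneg z).eq_or_lt with h0 | h0
  · rw [← h0]
    positivity
  · nlinarith

theorem opNorm_scatter_le {B κ : ℝ} (hB : 0 ≤ B) (hκ : 0 ≤ κ) (hw : ∀ i, |w i| ≤ κ)
    (hx : ∀ v : EuclideanSpace ℝ (Fin p), ∑ i, ((x i).ofLp ⬝ᵥ v.ofLp) ^ 2 ≤ B * ‖v‖ ^ 2) :
    opNorm (scatter x w) ≤ κ * B := by
  refine opNorm_le_of_dotProduct (by positivity) fun a b => ?_
  rw [dotProduct_scatter_mulVec]
  have h1 : |∑ j, w j * (((x j).ofLp ⬝ᵥ a.ofLp) * ((x j).ofLp ⬝ᵥ b.ofLp))| ≤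
      κ * ∑ j, |(x j).ofLp ⬝ᵥ a.ofLp| * |(x j).ofLp ⬝ᵥ b.ofLp| := by
    rw [Finset.mul_sum]
    refine (Finset.abs_sum_le_sum_abs _ _).trans (Finset.sum_le_sum fun j _ => ?_)
    rw [abs_mul, abs_mul]
    exact mul_le_mul_of_nonneg_right (hw j) (by positivity)
  have h2 : (∑ j, |(x j).ofLp ⬝ᵥ a.ofLp| * |(x j).ofLp ⬝ᵥ b.ofLp|) ^ 2 ≤
      (B * (‖a‖ * ‖b‖)) ^ 2 := by
    refine (Finset.sum_mul_sq_le_sq_mul_sq _ _ _).trans ?_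
    simp_rw [sq_abs]
    calc _ ≤ (B * ‖a‖ ^ 2) * (B * ‖b‖ ^ 2) :=
          mul_le_mul (hx a) (hx b) (Finset.sum_nonneg fun _ _ => sq_nonneg _) (by positivity)
      _ = _ := by ring
  have h3 := abs_le_of_sq_le_sq' h2 (by positivity)
  calc _ ≤ κ * (B * (‖a‖ * ‖b‖)) := h1.trans (mul_le_mul_of_nonneg_left h3.2 hκ)
    _ = _ := by ring

theorem goodSample_one {u : ℝ → ℝ} {y : ℝ} (hu : ∀ t, 0 ≤ t → 0 < u t)
    (hut : 0 < u (psiInv u y)) (hn : 0 < n) (hS : (scatter x 1).PosDef)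
    (hex : ∃! w : Fin n → ℝ, (∀ i, 0 < w i) ∧ ∀ i, w i = u (lev x w i)) {B κ : ℝ} (hB : 0 ≤ B)
    (hκ : 0 ≤ κ)
    (hclose : ∀ w : Fin n → ℝ, (∀ i, 0 < w i) → (∀ i, w i = u (lev x w i)) →
      ∀ i, |w i / u (psiInv u y) - 1| ≤ κ)
    (hx : ∀ v : EuclideanSpace ℝ (Fin p), ∑ i, ((x i).ofLp ⬝ᵥ v.ofLp) ^ 2 ≤ n * B * ‖v‖ ^ 2) :
    GoodSample u y 1 (κ * B) x := by
  have hn' : (0 : ℝ) < n := by exact_mod_cast hn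
  constructor
  · obtain ⟨w, ⟨hw, hfix⟩, huniq⟩ := hex
    refine ⟨scatter x w, (isMEstimator_iff_exists hS hu).mpr ⟨w, hw, hfix, rfl⟩, fun S hM => ?_⟩
    obtain ⟨w', hw', hfix', rfl⟩ := (isMEstimator_iff_exists hS hu).mp hM
    rw [huniq w' ⟨hw', hfix'⟩]
  · intro S hM
    obtain ⟨w, hw, hfix, rfl⟩ := (isMEstimator_iff_exists hS hu).mp hM
    -- The error matrix is itself a scatter matrix, with signed weights of size at most `κ / n`.
    have h1 : whiten 1 ((1 / (n * u (psiInv u y))) • scatter x w - sampleCov x) =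
        scatter x fun i => 1 / n * (w i / u (psiInv u y) - 1) := by
      simp only [whiten, CFC.sqrt_one, inv_one, one_mul, mul_one, scatter, sampleCov,
        Finset.smul_sum, ← Finset.sum_sub_distrib, smul_smul, ← sub_smul]
      refine Finset.sum_congr rfl fun i _ => ?_
      congr 1
      field_simp
    rw [h1]
    have h2 := opNorm_scatter_le (B := n * B) (κ := 1 / n * κ)
      (w := fun i => 1 / n * (w i / u (psiInv u y) - 1)) (by positivity) (by positivity)
      (fun i => by
        rw [abs_mul, abs_of_pos (by positivity : 0 < 1 / (n : ℝ))]
        exact mul_le_mul_of_nonneg_left (hclose w hw hfix i) (by positivity)) hx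
    refine h2.trans_eq ?_
    field_simp

/-- Affine equivariance: `S ↦ R⁻¹ S R⁻¹` is a bijection between the estimators of the sample `R zᵢ`
and those of `zᵢ`, and the whitened error is exactly the error for `z`. -/
theorem goodSample_of_sqrt {u : ℝ → ℝ} {y ε : ℝ} {T : Matrix (Fin p) (Fin p) ℝ} (hT : T.PosDef)
    {z : Fin n → EuclideanSpace ℝ (Fin p)} (hz : GoodSample u y 1 ε z) :
    GoodSample u y T ε fun i => Matrix.toEuclideanCLM (𝕜 := ℝ) (CFC.sqrt T) (z i) := by
  set R := CFC.sqrt T with hR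
  have hRh : R.IsHermitian := (Matrix.nonneg_iff_posSemidef.mp (CFC.sqrt_nonneg T)).isHermitian
  have hRT : R.transpose = R := by simpa [Matrix.IsHermitian] using hRh
  have hRR : R * R = T := CFC.sqrt_mul_sqrt_self T hT.posSemidef.nonneg
  have hRu : IsUnit R.det := by
    have h1 := (Matrix.isUnit_iff_isUnit_det _).mp hT.isUnit
    rw [← hRR, Matrix.det_mul] at h1
    exact isUnit_of_mul_isUnit_left h1
  have hRit : R⁻¹.transpose = R⁻¹ := by rw [Matrix.transpose_nonsing_inv, hRT]
  have hof : ∀ i, (Matrix.toEuclideanCLM (𝕜 := ℝ) R (z i)).ofLp = R.mulVec (z i).ofLp :=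
    fun i => rfl
  have houter : ∀ i, outer (Matrix.toEuclideanCLM (𝕜 := ℝ) R (z i)) = R * outer (z i) * R := by
    intro i
    rw [outer, outer, hof, Matrix.mul_vecMulVec, Matrix.vecMulVec_mul]
    congr 1
    rw [← Matrix.mulVec_transpose, hRT]
  have houter' : ∀ i, R⁻¹ * outer (Matrix.toEuclideanCLM (𝕜 := ℝ) R (z i)) * R⁻¹ = outer (z i) := by
    intro i
    rw [houter, Matrix.mul_assoc R, Matrix.nonsing_inv_mul_cancel_left _ _ hRu,
      Matrix.mul_nonsing_inv_cancel_right _ _ hRu]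
  have hquad : ∀ (S : Matrix (Fin p) (Fin p) ℝ) i,
      quad (R⁻¹ * S * R⁻¹)⁻¹ (z i) = quad S⁻¹ (Matrix.toEuclideanCLM (𝕜 := ℝ) R (z i)) := by
    intro S i
    rw [quad, quad, hof, Matrix.mul_inv_rev, Matrix.mul_inv_rev, Matrix.nonsing_inv_nonsing_inv _ hRu,
      ← Matrix.mulVec_mulVec, ← Matrix.mulVec_mulVec, Matrix.dotProduct_mulVec _ R,
      ← Matrix.mulVec_transpose, hRT]
  have hiff : ∀ S, IsMEstimator u (fun i => Matrix.toEuclideanCLM (𝕜 := ℝ) R (z i)) S ↔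
      IsMEstimator u z (R⁻¹ * S * R⁻¹) := by
    intro S
    have hinj : Function.Injective R⁻¹.mulVec :=
      Matrix.mulVec_injective_of_isUnit ((Matrix.isUnit_iff_isUnit_det _).mpr
        (by simpa using hRu.ringInverse))
    have hinj' : Function.Injective R.mulVec :=
      Matrix.mulVec_injective_of_isUnit ((Matrix.isUnit_iff_isUnit_det _).mpr hRu)
    unfold IsMEstimator
    refine and_congr ⟨fun h => ?_, fun h => ?_⟩ ⟨fun h => ?_, fun h => ?_⟩
    · have := h.conjTranspose_mul_mul_same hinj
      rwa [Matrix.conjTranspose_eq_transpose_of_trivial, hRit] at this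
    · have := h.conjTranspose_mul_mul_same hinj'
      rwa [Matrix.conjTranspose_eq_transpose_of_trivial, hRT, Matrix.mul_assoc R⁻¹,
        Matrix.mul_nonsing_inv_cancel_left _ _ hRu, Matrix.nonsing_inv_mul_cancel_right _ _ hRu] at this
    · simp_rw [hquad]
      conv_lhs => rw [h]
      simp_rw [Finset.mul_sum, Finset.sum_mul, Matrix.mul_smul, Matrix.smul_mul, houter']
    · simp_rw [hquad] at h
      have h2 : S = R * (R⁻¹ * S * R⁻¹) * R := by
        rw [Matrix.mul_assoc R⁻¹,
          Matrix.mul_nonsing_inv_cancel_left _ _ hRu, Matrix.nonsing_inv_mul_cancel_right _ _ hRu]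
      rw [h] at h2
      conv_lhs => rw [h2]
      simp_rw [Finset.mul_sum, Finset.sum_mul, Matrix.mul_smul, Matrix.smul_mul, houter]
  have hcov : R⁻¹ * sampleCov (fun i => Matrix.toEuclideanCLM (𝕜 := ℝ) R (z i)) * R⁻¹ =
      sampleCov z := by
    simp_rw [sampleCov, Matrix.mul_smul, Matrix.smul_mul, Finset.mul_sum, Finset.sum_mul, houter']
  obtain ⟨⟨S, hS, huniq⟩, hbound⟩ := hz
  constructor
  · refine ⟨R * S * R, (hiff _).mpr ?_, fun S' hS' => ?_⟩
    · rwa [Matrix.mul_assoc R, Matrix.nonsing_inv_mul_cancel_left _ _ hRu,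
        Matrix.mul_nonsing_inv_cancel_right _ _ hRu]
    · rw [← huniq _ ((hiff _).mp hS'), Matrix.mul_assoc R⁻¹,
        Matrix.mul_nonsing_inv_cancel_left _ _ hRu, Matrix.nonsing_inv_mul_cancel_right _ _ hRu]
  · intro S' hS'
    have h := hbound _ ((hiff _).mp hS')
    rw [whiten, ← hR, Matrix.mul_sub, Matrix.sub_mul, hcov, Matrix.mul_smul, Matrix.smul_mul]
    simpa [whiten] using h

end Scatter

/-! ### Chernoff bounds and one-dimensional Gaussian estimates -/

section Chernoff

variable {ι : Type*} [Fintype ι] {α : ι → Type*} [∀ i, MeasurableSpace (α i)]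

theorem lintegral_pi_exp_sum_le (ν : ∀ i, Measure (α i)) [∀ i, IsProbabilityMeasure (ν i)]
    {f : ∀ i, α i → ℝ} (hf : ∀ i, Measurable (f i)) {K : ι → ℝ}
    (hK : ∀ i, ∫⁻ t, ENNReal.ofReal (Real.exp (f i t)) ∂ν i ≤ ENNReal.ofReal (Real.exp (K i))) :
    ∫⁻ x, ENNReal.ofReal (Real.exp (∑ i, f i (x i))) ∂Measure.pi ν ≤
      ENNReal.ofReal (Real.exp (∑ i, K i)) := by
  have hm : ∀ i, Measurable fun t => ENNReal.ofReal (Real.exp (f i t)) := fun i => by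
    have := hf i
    fun_prop
  have hind := iIndepFun_pi (μ := ν) (X := fun i t => ENNReal.ofReal (Real.exp (f i t)))
    fun i => (hm i).aemeasurable
  simp_rw [Real.exp_sum, ENNReal.ofReal_prod_of_nonneg fun i _ => (Real.exp_pos _).le]
  rw [lintegral_prod_eq_prod_lintegral_of_indepFun Finset.univ
    (fun i (x : ∀ i, α i) => ENNReal.ofReal (Real.exp (f i (x i)))) hind
    fun i => (hm i).comp (measurable_pi_apply i)]
  refine Finset.prod_le_prod' fun i _ => ?_
  refine le_trans (le_of_eq ?_) (hK i)
  exact (measurePreserving_eval ν i).lintegral_comp (hm i)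

theorem measure_le_exp_of_lintegral_le {β : Type*} [MeasurableSpace β] {μ : Measure β} {f : β → ℝ}
    (hf : Measurable f) {K : ℝ}
    (hK : ∫⁻ x, ENNReal.ofReal (Real.exp (f x)) ∂μ ≤ ENNReal.ofReal (Real.exp K)) (t : ℝ) :
    μ {x | t ≤ f x} ≤ ENNReal.ofReal (Real.exp (K - t)) := by
  have h := (mul_meas_ge_le_lintegral (μ := μ)
    (f := fun x => ENNReal.ofReal (Real.exp (f x))) (by fun_prop)
    (ENNReal.ofReal (Real.exp t))).trans hK
  have hset : {x | ENNReal.ofReal (Real.exp t) ≤ ENNReal.ofReal (Real.exp (f x))} =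
      {x | t ≤ f x} := by
    ext x
    simp [ENNReal.ofReal_le_ofReal_iff (Real.exp_pos _).le]
  rw [hset] at h
  rw [Real.exp_sub, ENNReal.ofReal_div_of_pos (Real.exp_pos _)]
  rw [ENNReal.le_div_iff_mul_le (by simp [Real.exp_pos]) (by simp)]
  rwa [mul_comm]

theorem pi_measure_le_sum_le (ν : ∀ i, Measure (α i)) [∀ i, IsProbabilityMeasure (ν i)]
    {f : ∀ i, α i → ℝ} (hf : ∀ i, Measurable (f i)) {K : ι → ℝ}
    (hK : ∀ i, ∫⁻ t, ENNReal.ofReal (Real.exp (f i t)) ∂ν i ≤ ENNReal.ofReal (Real.exp (K i)))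
    (t : ℝ) :
    Measure.pi ν {x | t ≤ ∑ i, f i (x i)} ≤ ENNReal.ofReal (Real.exp (∑ i, K i - t)) :=
  measure_le_exp_of_lintegral_le
    (Finset.measurable_sum _ fun i _ => (hf i).comp (measurable_pi_apply i))
    (lintegral_pi_exp_sum_le ν hf hK) t

end Chernoff

/-- This is `-log (1 - x) ≤ x + x²`, applied at `x = 2s` to the chi-square Laplace transform `(1 -
2s)^(-1/2)`. -/
theorem one_le_one_sub_mul_exp {x : ℝ} (h2 : x ≤ 1 / 2) :
    1 ≤ (1 - x) * Real.exp (x + x ^ 2) := by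
  rcases le_total x 0 with h | h
  · have := Real.add_one_le_exp (x + x ^ 2)
    calc 1 ≤ (1 - x) * (x + x ^ 2 + 1) := by nlinarith [mul_nonneg (neg_nonneg.mpr h) (sq_nonneg x)]
      _ ≤ _ := mul_le_mul_of_nonneg_left this (by linarith)
  · have := Real.quadratic_le_exp_of_nonneg (by positivity : 0 ≤ x + x ^ 2)
    refine le_trans ?_ (mul_le_mul_of_nonneg_left this (by linarith))
    have : 0 ≤ x ^ 2 * ((1 - x) * (1 + x) ^ 2 - 2 * x) :=
      mul_nonneg (sq_nonneg x) (by
        have e1 := mul_nonneg h (sub_nonneg.mpr h2)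
        have e2 := mul_nonneg (mul_nonneg h h) (sub_nonneg.mpr h2)
        nlinarith)
    nlinarith

theorem lintegral_exp_sq_gaussianReal_le {s : ℝ} (hs : |s| ≤ 1 / 4) :
    ∫⁻ t, ENNReal.ofReal (Real.exp (s * t ^ 2)) ∂gaussianReal 0 1 ≤
      ENNReal.ofReal (Real.exp (s + 2 * s ^ 2)) := by
  rw [abs_le] at hs
  have hb : 0 < 1 / 2 - s := by linarith
  have hpt : ∀ t : ℝ, gaussianPDFReal 0 1 t * Real.exp (s * t ^ 2) =
      (√(2 * Real.pi))⁻¹ * Real.exp (-(1 / 2 - s) * t ^ 2) := by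
    intro t
    rw [gaussianPDFReal, mul_assoc, ← Real.exp_add]
    simp only [NNReal.coe_one, mul_one, sub_zero]
    congr 2
    ring
  rw [gaussianReal_of_var_ne_zero 0 one_ne_zero,
    lintegral_withDensity_eq_lintegral_mul _ (measurable_gaussianPDF 0 1) (by fun_prop)]
  simp only [Pi.mul_apply, gaussianPDF]
  simp_rw [← ENNReal.ofReal_mul (gaussianPDFReal_nonneg _ _ _), hpt]
  rw [← ofReal_integral_eq_lintegral_ofReal ((integrable_exp_neg_mul_sq hb).const_mul _)
    (ae_of_all _ fun t => by positivity), integral_const_mul, integral_gaussian]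
  apply ENNReal.ofReal_le_ofReal
  have h1 : √(Real.pi / (1 / 2 - s)) = √(2 * Real.pi) * √((1 - 2 * s)⁻¹) := by
    rw [← Real.sqrt_mul (by positivity)]
    congr 1
    have : 1 - 2 * s ≠ 0 := by linarith
    have : 1 / 2 - s ≠ 0 := by linarith
    field_simp
  have h2 : √(2 * Real.pi) ≠ 0 := by positivity
  rw [h1, inv_mul_cancel_left₀ h2]
  apply Real.sqrt_le_iff.mpr
  refine ⟨(Real.exp_pos _).le, ?_⟩
  have e : ((2 : ℕ) : ℝ) * (s + 2 * s ^ 2) = 2 * s + (2 * s) ^ 2 := by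
    push_cast
    ring
  rw [← Real.exp_nat_mul, inv_le_iff_one_le_mul₀' (by linarith), e]
  exact one_le_one_sub_mul_exp (by linarith)

theorem gaussianReal_abs_lt_le (c : ℝ) :
    gaussianReal 0 1 {t | |t| < c} ≤ ENNReal.ofReal c := by
  rw [gaussianReal_apply 0 one_ne_zero]
  have hb : ∀ t, gaussianPDF 0 1 t ≤ ENNReal.ofReal (1 / 2) := by
    intro t
    apply ENNReal.ofReal_le_ofReal
    rw [gaussianPDFReal]
    have h1 : Real.exp (-(t - 0) ^ 2 / (2 * ((1 : NNReal) : ℝ))) ≤ 1 :=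
      Real.exp_le_one_iff.mpr (by
        apply div_nonpos_of_nonpos_of_nonneg
        · nlinarith [sq_nonneg (t - 0)]
        · positivity)
    have h2 : (√(2 * Real.pi * ((1 : NNReal) : ℝ)))⁻¹ ≤ 1 / 2 := by
      rw [one_div]
      apply inv_anti₀ two_pos
      apply Real.le_sqrt_of_sq_le
      have := Real.pi_gt_three
      simp
      linarith
    calc _ ≤ 1 / 2 * 1 := mul_le_mul h2 h1 (Real.exp_pos _).le (by norm_num)
      _ = 1 / 2 := mul_one _
  refine (setLIntegral_mono measurable_const fun t _ => hb t).trans ?_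
  have : {t : ℝ | |t| < c} = Set.Ioo (-c) c := by
    ext t
    simp [abs_lt]
  rw [setLIntegral_const, this, Real.volume_Ioo, ← ENNReal.ofReal_mul (by norm_num)]
  apply ENNReal.ofReal_le_ofReal
  linarith

/-- The density is at most `1/2`, so the event has probability at most `1/20`, and `e - 1 ≤ 2`. -/
theorem lintegral_exp_indicator_gaussianReal_le :
    ∫⁻ t, ENNReal.ofReal (Real.exp (if |t| < 1 / 20 then 1 else 0)) ∂gaussianReal 0 1 ≤
      ENNReal.ofReal (Real.exp (1 / 10)) := by
  have hm : MeasurableSet {t : ℝ | |t| < 1 / 20} := measurableSet_lt (by fun_prop) measurable_const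
  have h1 : ∀ t : ℝ, ENNReal.ofReal (Real.exp (if |t| < 1 / 20 then 1 else 0)) ≤
      1 + {t : ℝ | |t| < 1 / 20}.indicator (fun _ => ENNReal.ofReal 2) t := by
    intro t
    by_cases h : |t| < 1 / 20
    · rw [if_pos h, Set.indicator_of_mem (by exact h), ← ENNReal.ofReal_one,
        ← ENNReal.ofReal_add (by norm_num) (by norm_num)]
      apply ENNReal.ofReal_le_ofReal
      have := Real.exp_one_lt_d9
      linarith
    · rw [if_neg h, Set.indicator_of_notMem (by exact h)]
      simp
  refine (lintegral_mono h1).trans ?_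
  rw [lintegral_add_left measurable_const, lintegral_indicator_const hm]
  have h2 := gaussianReal_abs_lt_le (1 / 20)
  calc _ ≤ ENNReal.ofReal 1 + ENNReal.ofReal 2 * ENNReal.ofReal (1 / 20) := by
        gcongr
        simp
    _ = ENNReal.ofReal (1 + 2 * (1 / 20)) := by
        rw [← ENNReal.ofReal_mul (by norm_num), ← ENNReal.ofReal_add (by norm_num) (by norm_num)]
    _ ≤ _ := by
        apply ENNReal.ofReal_le_ofReal
        have := Real.add_one_le_exp (1 / 10 : ℝ)
        linarith

/-! ### Standard Gaussian measures: products, marginals, null subspaces -/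

section StdGaussian

variable {F : Type*} [NormedAddCommGroup F] [InnerProductSpace ℝ F] [FiniteDimensional ℝ F]
  [MeasurableSpace F] [BorelSpace F]

theorem map_pi_stdGaussian {ι : Type*} [Fintype ι] :
    (Measure.pi fun _ : ι => stdGaussian F).map (WithLp.toLp 2) =
      stdGaussian (PiLp 2 fun _ : ι => F) := by
  apply Measure.ext_of_charFun
  ext t
  rw [charFun_stdGaussian, charFun_pi]
  simp_rw [charFun_stdGaussian, ← Complex.exp_sum, ← Complex.ofReal_pow, PiLp.norm_sq_eq_of_L2]
  simp [Finset.sum_div, neg_div]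

theorem stdGaussian_map_inner (b : F) :
    (stdGaussian F).map (fun x => inner ℝ b x) = (gaussianReal 0 1).map (fun t => ‖b‖ * t) := by
  have h := IsGaussian.map_eq_gaussianReal (μ := stdGaussian F) (innerSL ℝ b)
  rw [integral_strongDual_stdGaussian, variance_dual_stdGaussian, innerSL_apply_norm] at h
  rw [gaussianReal_map_const_mul]
  refine Eq.trans (by rfl) (h.trans ?_)
  congr 1
  · simp
  · ext
    simp

theorem stdGaussian_submodule_eq_zero {U : Submodule ℝ F} (hU : U ≠ ⊤) :
    stdGaussian F (U : Set F) = 0 := by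
  obtain ⟨a, haU, ha⟩ := Submodule.exists_mem_ne_zero_of_ne_bot
    (mt Submodule.orthogonal_eq_bot_iff.mp hU)
  refine measure_mono_null (t := (fun x => inner ℝ a x) ⁻¹' {0})
    (fun x hx => Submodule.inner_left_of_mem_orthogonal hx haU) ?_
  have hm : Measurable fun x : F => inner ℝ a x := by fun_prop
  rw [← Measure.map_apply hm (measurableSet_singleton 0), stdGaussian_map_inner,
    Measure.map_apply (by fun_prop) (measurableSet_singleton 0)]
  have : (fun t : ℝ => ‖a‖ * t) ⁻¹' {0} = {0} := by
    ext t
    simp [ha]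
  rw [this]
  have := nullSingletonClass_gaussianReal (μ := 0) (v := 1) one_ne_zero
  exact measure_singleton 0

/-- Induction with Fubini: fewer than `finrank` vectors span a proper subspace, which a further
independent Gaussian vector almost surely avoids. -/
theorem ae_linearIndependent_stdGaussian {p : ℕ} (hp : p ≤ Module.finrank ℝ F) :
    ∀ᵐ c ∂(Measure.pi fun _ : Fin p => stdGaussian F), LinearIndependent ℝ c := by
  induction p with
  | zero => exact ae_of_all _ fun c => linearIndependent_empty_type
  | succ p ih =>
    have hmp := measurePreserving_piFinSuccAbove (fun _ : Fin (p + 1) => stdGaussian F) 0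
    have hmeas : MeasurableSet {q : F × (Fin p → F) | LinearIndependent ℝ (Fin.cons q.1 q.2 : Fin (p + 1) → F)} := by
      have h1 : IsOpen {c : Fin (p + 1) → F | LinearIndependent ℝ c} :=
        isOpen_setOfPred_linearIndependent
      refine h1.measurableSet.preimage ?_
      refine measurable_pi_lambda _ fun i => ?_
      refine Fin.cases ?_ (fun j => ?_) i
      · exact measurable_fst
      · exact (measurable_pi_apply j).comp measurable_snd
    have hae : ∀ᵐ q ∂((stdGaussian F).prod (Measure.pi fun _ : Fin p => stdGaussian F)),
        LinearIndependent ℝ (Fin.cons q.1 q.2 : Fin (p + 1) → F) := by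
      rw [ae_iff]
      have hm' : MeasurableSet {q : F × (Fin p → F) |
          ¬ LinearIndependent ℝ (Fin.cons q.1 q.2 : Fin (p + 1) → F)} := hmeas.compl
      rw [Measure.prod_apply_symm hm', lintegral_eq_zero_iff (measurable_measure_prodMk_right hm')]
      filter_upwards [ih (by omega)] with c hc
      have hne : Submodule.span ℝ (Set.range c) ≠ ⊤ := by
        intro h
        have h1 := finrank_span_eq_card hc
        rw [h, finrank_top, Fintype.card_fin] at h1
        omega
      refine measure_mono_null (fun v hv => ?_) (stdGaussian_submodule_eq_zero hne)
      by_contra hv'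
      exact hv (linearIndependent_finCons.mpr ⟨hc, hv'⟩)
    have := hmp.quasiMeasurePreserving.ae hae
    filter_upwards [this] with c hc
    convert hc using 1
    ext i
    refine Fin.cases ?_ (fun j => ?_) i
    · rfl
    · rfl

end StdGaussian

/-! ### Rows and columns of a Gaussian matrix, and its operator norm -/

section Rows

variable {n p : ℕ}

/-- The rows of the matrix with given columns. -/
def rows (c : Fin p → EuclideanSpace ℝ (Fin n)) : Fin n → EuclideanSpace ℝ (Fin p) :=
  fun i => WithLp.toLp 2 fun a => c a i

theorem measurable_rows : Measurable (rows (n := n) (p := p)) := by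
  unfold rows
  fun_prop

/-- Transposition as an isometry. -/
noncomputable def rowsIsometry (n p : ℕ) :
    (PiLp 2 fun _ : Fin p => EuclideanSpace ℝ (Fin n)) ≃ₗᵢ[ℝ]
      (PiLp 2 fun _ : Fin n => EuclideanSpace ℝ (Fin p)) where
  toFun v := WithLp.toLp 2 (rows v.ofLp)
  invFun v := WithLp.toLp 2 (rows v.ofLp)
  map_add' _ _ := rfl
  map_smul' _ _ := rfl
  left_inv _ := rfl
  right_inv _ := rfl
  norm_map' v := by
    rw [← sq_eq_sq₀ (norm_nonneg _) (norm_nonneg _), PiLp.norm_sq_eq_of_L2, PiLp.norm_sq_eq_of_L2]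
    simp only [EuclideanSpace.norm_sq_eq]
    exact Finset.sum_comm

/-- Transposition is an isometry and standard Gaussians are isometry invariant. This turns `n`
samples in `ℝᵖ` into `p` columns in `ℝⁿ`, where the hat matrix is a projection onto a random
subspace. -/
theorem measurePreserving_rows :
    MeasurePreserving (rows (n := n) (p := p))
      (Measure.pi fun _ : Fin p => stdGaussian (EuclideanSpace ℝ (Fin n)))
      (Measure.pi fun _ : Fin n => stdGaussian (EuclideanSpace ℝ (Fin p))) := by
  refine ⟨measurable_rows, ?_⟩
  apply (MeasurableEquiv.toLp 2 (Fin n → EuclideanSpace ℝ (Fin p))).map_measurableEquiv_injective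
  have h1 : ((Measure.pi fun _ : Fin p => stdGaussian (EuclideanSpace ℝ (Fin n))).map
      (WithLp.toLp 2)).map (rowsIsometry n p) =
      stdGaussian (PiLp 2 fun _ : Fin n => EuclideanSpace ℝ (Fin p)) := by
    rw [map_pi_stdGaussian, stdGaussian_map]
  rw [Measure.map_map (rowsIsometry n p).continuous.measurable (by fun_prop)] at h1
  rw [MeasurableEquiv.coe_toLp, map_pi_stdGaussian, ← h1, Measure.map_map (by fun_prop) measurable_rows]
  rfl

/-- The linear map `b ↦ (⟨xᵢ, b⟩)ᵢ`. -/
noncomputable def design (x : Fin n → EuclideanSpace ℝ (Fin p)) :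
    EuclideanSpace ℝ (Fin p) →L[ℝ] EuclideanSpace ℝ (Fin n) :=
  LinearMap.toContinuousLinearMap
    { toFun := fun b => WithLp.toLp 2 fun i => inner ℝ b (x i)
      map_add' := fun a b => by ext i; simp [inner_add_left]
      map_smul' := fun r b => by ext i; simp [inner_smul_left] }

theorem norm_design_sq (x : Fin n → EuclideanSpace ℝ (Fin p)) (b : EuclideanSpace ℝ (Fin p)) :
    ‖design x b‖ ^ 2 = ∑ i, inner ℝ b (x i) ^ 2 := by
  rw [EuclideanSpace.norm_sq_eq]
  simp [design]

theorem lintegral_exp_norm_design_sq_le {b : EuclideanSpace ℝ (Fin p)} (hb : ‖b‖ ≤ 1) :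
    ∫⁻ x, ENNReal.ofReal (Real.exp (‖design x b‖ ^ 2 / 4))
      ∂(Measure.pi fun _ : Fin n => stdGaussian (EuclideanSpace ℝ (Fin p))) ≤
      ENNReal.ofReal (Real.exp (3 / 8 * n)) := by
  have h1 : ∀ _ : Fin n, ∫⁻ z, ENNReal.ofReal (Real.exp (inner ℝ b z ^ 2 / 4))
      ∂stdGaussian (EuclideanSpace ℝ (Fin p)) ≤ ENNReal.ofReal (Real.exp (3 / 8)) := by
    intro _
    have hg : Measurable fun t : ℝ => ENNReal.ofReal (Real.exp (t ^ 2 / 4)) := by fun_prop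
    have h2 := lintegral_map (μ := stdGaussian (EuclideanSpace ℝ (Fin p))) hg
      (by fun_prop : Measurable fun z => inner ℝ b z)
    rw [← h2, stdGaussian_map_inner, lintegral_map hg (by fun_prop)]
    have hb2 : ‖b‖ ^ 2 ≤ 1 := pow_le_one₀ (norm_nonneg _) hb
    refine (lintegral_mono fun t => ?_).trans
      (lintegral_exp_sq_gaussianReal_le (s := 1 / 4) (by norm_num [abs_of_pos])) |>.trans ?_
    · apply ENNReal.ofReal_le_ofReal
      apply Real.exp_le_exp.mpr
      nlinarith [mul_nonneg (sub_nonneg.mpr hb2) (sq_nonneg t)]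
    · norm_num
  have h3 := lintegral_pi_exp_sum_le (fun _ : Fin n => stdGaussian (EuclideanSpace ℝ (Fin p)))
    (f := fun _ z => inner ℝ b z ^ 2 / 4) (fun _ => by fun_prop) h1
  simp_rw [norm_design_sq, Finset.sum_div]
  refine h3.trans_eq ?_
  simp [mul_comm]

/-- Averaging `exp (‖X b‖² / 4)` over the unit ball replaces a net. If `‖X‖` is large, the integrand
is large on a ball of radius `1/4`, whose volume fraction `4⁻ᵖ ≥ exp (-2n)` is affordable. -/
theorem measure_norm_design_gt_le (hpn : p ≤ n) :
    (Measure.pi fun _ : Fin n => stdGaussian (EuclideanSpace ℝ (Fin p)))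
      {x | 256 * (n : ℝ) < ‖design x‖ ^ 2} ≤ ENNReal.ofReal (Real.exp (-n)) := by
  set μ := Measure.pi fun _ : Fin n => stdGaussian (EuclideanSpace ℝ (Fin p))
  set ball := Metric.ball (0 : EuclideanSpace ℝ (Fin p)) 1
  have hvol0 : volume ball ≠ 0 := (Metric.measure_ball_pos _ _ one_pos).ne'
  have hvolt : volume ball ≠ ⊤ := measure_ball_lt_top.ne
  have hmeas : Measurable fun q : (Fin n → EuclideanSpace ℝ (Fin p)) × EuclideanSpace ℝ (Fin p) =>
      ENNReal.ofReal (Real.exp (‖design q.1 q.2‖ ^ 2 / 4)) := by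
    simp_rw [norm_design_sq]
    fun_prop
  have hint : ∫⁻ x, (∫⁻ b in ball, ENNReal.ofReal (Real.exp (‖design x b‖ ^ 2 / 4))) ∂μ ≤
      ENNReal.ofReal (Real.exp (3 / 8 * n)) * volume ball := by
    rw [lintegral_lintegral_swap hmeas.aemeasurable]
    refine (setLIntegral_mono measurable_const fun b hb =>
      lintegral_exp_norm_design_sq_le ?_).trans_eq (setLIntegral_const _ _)
    exact (mem_ball_zero_iff.mp hb).le
  have hlow : ∀ x : Fin n → EuclideanSpace ℝ (Fin p), 256 * (n : ℝ) < ‖design x‖ ^ 2 →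
      ENNReal.ofReal (Real.exp (4 * n) * (1 / 4) ^ p) * volume ball ≤
      ∫⁻ b in ball, ENNReal.ofReal (Real.exp (‖design x b‖ ^ 2 / 4)) := by
    intro x hx
    have hX0 : 0 < ‖design x‖ := by
      refine (norm_nonneg _).lt_of_ne fun h => ?_
      rw [← h] at hx
      have : (0 : ℝ) ≤ n := by positivity
      nlinarith
    -- On the ball of radius `1/4` around `(3/4) v`, `‖X b‖ ≥ (3/4)(2/3)‖X‖ - ‖X‖/4 = ‖X‖/4`, so the
    -- exponent is at least `256 n / 64 = 4n`.
    obtain ⟨v, hv1, hv⟩ := (design x).exists_lt_apply_of_lt_opNorm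
      (r := 2 / 3 * ‖design x‖) (by linarith)
    have hsub : Metric.ball ((3 / 4 : ℝ) • v) (1 / 4) ⊆ ball := by
      intro b hb
      rw [mem_ball_iff_norm] at hb
      rw [mem_ball_zero_iff]
      have h1 := norm_add_le (b - (3 / 4 : ℝ) • v) ((3 / 4 : ℝ) • v)
      rw [sub_add_cancel, norm_smul, Real.norm_of_nonneg (by norm_num)] at h1
      linarith
    have hval : ∀ b ∈ Metric.ball ((3 / 4 : ℝ) • v) (1 / 4),
        ENNReal.ofReal (Real.exp (4 * n)) ≤ ENNReal.ofReal (Real.exp (‖design x b‖ ^ 2 / 4)) := by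
      intro b hb
      rw [mem_ball_iff_norm] at hb
      have h1 := norm_sub_norm_le (design x ((3 / 4 : ℝ) • v)) (design x b)
      have h2 := (design x).le_opNorm ((3 / 4 : ℝ) • v - b)
      rw [norm_sub_rev] at hb
      rw [← map_sub, map_smul, norm_smul, Real.norm_of_nonneg (by norm_num)] at h1
      have h3 : ‖design x‖ / 4 ≤ ‖design x b‖ := by nlinarith
      have h4 : (‖design x‖ / 4) ^ 2 ≤ ‖design x b‖ ^ 2 := by gcongr
      apply ENNReal.ofReal_le_ofReal
      apply Real.exp_le_exp.mpr
      linarith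
    calc _ = ENNReal.ofReal (Real.exp (4 * n)) * volume (Metric.ball ((3 / 4 : ℝ) • v) (1 / 4)) := by
          rw [Measure.addHaar_ball_of_pos _ ((3 / 4 : ℝ) • v) (by norm_num), finrank_euclideanSpace, Fintype.card_fin,
            ENNReal.ofReal_mul (Real.exp_pos _).le, mul_assoc]
      _ = ∫⁻ b in Metric.ball ((3 / 4 : ℝ) • v) (1 / 4), ENNReal.ofReal (Real.exp (4 * n)) :=
          (setLIntegral_const _ _).symm
      _ ≤ ∫⁻ b in Metric.ball ((3 / 4 : ℝ) • v) (1 / 4),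
            ENNReal.ofReal (Real.exp (‖design x b‖ ^ 2 / 4)) :=
          setLIntegral_mono' measurableSet_ball hval
      _ ≤ _ := lintegral_mono_set hsub
  have hmarkov := (mul_meas_ge_le_lintegral (μ := μ)
    (f := fun x => ∫⁻ b in ball, ENNReal.ofReal (Real.exp (‖design x b‖ ^ 2 / 4)))
    hmeas.lintegral_prod_right' (ENNReal.ofReal (Real.exp (4 * n) * (1 / 4) ^ p) * volume ball)).trans
    hint
  have h1 : ENNReal.ofReal (Real.exp (4 * n) * (1 / 4) ^ p) * volume ball *
      μ {x | 256 * (n : ℝ) < ‖design x‖ ^ 2} ≤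
      ENNReal.ofReal (Real.exp (3 / 8 * n)) * volume ball :=
    (mul_le_mul_right (measure_mono fun x hx => hlow x hx) _).trans hmarkov
  rw [mul_right_comm] at h1
  have h2 := (ENNReal.mul_le_mul_iff_left hvol0 hvolt).mp h1
  have hq : 0 < Real.exp (4 * n) * (1 / 4 : ℝ) ^ p := by positivity
  have h3 : μ {x | 256 * (n : ℝ) < ‖design x‖ ^ 2} ≤
      ENNReal.ofReal (Real.exp (3 / 8 * n)) / ENNReal.ofReal (Real.exp (4 * n) * (1 / 4) ^ p) := by
    rw [ENNReal.le_div_iff_mul_le (Or.inl (ENNReal.ofReal_pos.mpr hq).ne')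
      (Or.inl ENNReal.ofReal_ne_top)]
    rwa [mul_comm]
  refine h3.trans ?_
  rw [← ENNReal.ofReal_div_of_pos hq]
  apply ENNReal.ofReal_le_ofReal
  rw [div_le_iff₀ hq]
  have h4 : Real.exp (-(2 * n)) ≤ (1 / 4 : ℝ) ^ p := by
    have h5 : Real.exp (-2) ≤ 1 / 4 := by
      rw [Real.exp_neg, one_div]
      apply inv_anti₀ (by norm_num)
      have h6 := Real.quadratic_le_exp_of_nonneg (x := 2) (by norm_num)
      norm_num at h6
      linarith
    calc Real.exp (-(2 * n)) = Real.exp (-2) ^ n := by rw [← Real.exp_nat_mul]; ring_nf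
      _ ≤ (1 / 4) ^ n := by gcongr
      _ ≤ (1 / 4) ^ p := pow_le_pow_of_le_one (by norm_num) (by norm_num) hpn
  calc Real.exp (3 / 8 * n) ≤ Real.exp (-n + (4 * n + -(2 * n))) := by
        apply Real.exp_le_exp.mpr
        have : (0 : ℝ) ≤ n := by positivity
        linarith
    _ = Real.exp (-n) * (Real.exp (4 * n) * Real.exp (-(2 * n))) := by
        rw [Real.exp_add, Real.exp_add]
    _ ≤ _ := by gcongr

end Rows

/-! ### Concentration of Gaussian quadratic forms -/

section Quadratic

variable {n : ℕ}

theorem pi_gaussian_measure_nonneg_le {ε : ℝ} (hε : 0 < ε) (hε1 : ε ≤ 1) {κ : Fin n → ℝ}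
    (hκ : ∀ i, |κ i| ≤ 2) (hsum : ∑ i, κ i ≤ -(n * ε)) :
    (Measure.pi fun _ : Fin n => gaussianReal 0 1) {x | 0 ≤ ∑ i, κ i * x i ^ 2} ≤
      ENNReal.ofReal (Real.exp (-(n * ε ^ 2 / 32))) := by
  have habs : ∀ i, |ε / 16 * κ i| ≤ 1 / 4 := fun i => by
    rw [abs_mul, abs_of_pos (by positivity)]
    have := hκ i
    have := abs_nonneg (κ i)
    nlinarith
  -- With Chernoff parameter `ε / 16`, the linear term gives `-n ε² / 16` and the quadratic term
  -- costs at most `n ε² / 32`.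
  have h := pi_measure_le_sum_le (fun _ : Fin n => gaussianReal 0 1)
    (f := fun i t => ε / 16 * κ i * t ^ 2) (fun i => by fun_prop)
    (fun i => lintegral_exp_sq_gaussianReal_le (habs i)) 0
  have hset : {x : Fin n → ℝ | 0 ≤ ∑ i, κ i * x i ^ 2} =
      {x | 0 ≤ ∑ i, ε / 16 * κ i * x i ^ 2} := by
    ext x
    simp_rw [Set.mem_ofPred_eq, mul_assoc (ε / 16), ← Finset.mul_sum]
    exact (mul_nonneg_iff_of_pos_left (by positivity)).symm
  rw [hset]
  refine h.trans (ENNReal.ofReal_le_ofReal (Real.exp_le_exp.mpr ?_))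
  rw [sub_zero, Finset.sum_add_distrib, ← Finset.mul_sum]
  have h1 : ∑ i, 2 * (ε / 16 * κ i) ^ 2 ≤ ∑ _i : Fin n, ε ^ 2 / 32 := by
    refine Finset.sum_le_sum fun i _ => ?_
    have h2 : κ i ^ 2 ≤ 4 := by
      have := sq_le_sq' (abs_le.mp (hκ i)).1 (abs_le.mp (hκ i)).2
      linarith
    nlinarith [mul_nonneg (sq_nonneg ε) (sub_nonneg.mpr h2)]
  rw [Finset.sum_const, Finset.card_univ, Fintype.card_fin, nsmul_eq_mul] at h1
  have h3 := mul_le_mul_of_nonneg_left hsum (by positivity : 0 ≤ ε / 16)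
  linarith

/-- In an eigenbasis the form is `∑ ηᵢ xᵢ²` with `ηᵢ ∈ {0, 1}`. Scaling the deviation by `‖g‖²`
makes both tails events `0 ≤ ∑ κᵢ xᵢ²`, with no separate concentration of `‖g‖`. -/
theorem stdGaussian_projection_le {ε r : ℝ} (hε : 0 < ε) (hε1 : ε ≤ 1) (hr0 : 0 ≤ r) (hr1 : r ≤ 1)
    {H : Matrix (Fin n) (Fin n) ℝ} (hH : H.IsHermitian) (hH2 : H * H = H) (htr : H.trace = n * r) :
    stdGaussian (EuclideanSpace ℝ (Fin n))
      {g | ε * ‖g‖ ^ 2 ≤ |g.ofLp ⬝ᵥ H.mulVec g.ofLp - r * ‖g‖ ^ 2|} ≤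
      ENNReal.ofReal (2 * Real.exp (-(n * ε ^ 2 / 32))) := by
  set b := hH.eigenvectorBasis
  set η := hH.eigenvalues
  have hη : ∀ i, η i = 0 ∨ η i = 1 := by
    intro i
    have h1 := hH.mulVec_eigenvectorBasis i
    have h2 : H.mulVec (H.mulVec (b i).ofLp) = H.mulVec (b i).ofLp := by
      rw [Matrix.mulVec_mulVec, hH2]
    rw [h1, Matrix.mulVec_smul, h1, smul_smul] at h2
    have h3 : (b i).ofLp ≠ 0 := fun h => b.orthonormal.ne_zero i (by ext j; exact congrFun h j)
    have h4 := smul_left_injective ℝ h3 h2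
    have h5 : η i * (η i - 1) = 0 := by
      have : η i * η i = η i := h4
      linarith
    rcases mul_eq_zero.mp h5 with h | h
    · exact Or.inl h
    · exact Or.inr (by linarith)
  have hηsum : ∑ i, η i = n * r := by
    rw [← htr, hH.trace_eq_sum_eigenvalues]
    simp [η]
  have hquad : ∀ x : Fin n → ℝ, (∑ i, x i • b i).ofLp ⬝ᵥ H.mulVec (∑ i, x i • b i).ofLp =
      ∑ i, η i * x i ^ 2 := by
    intro x
    have hx : ∀ i, inner ℝ (b i) (∑ i, x i • b i) = x i := fun i => by
      simp [inner_sum, inner_smul_right, b.inner_eq_ite]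
    rw [← Matrix.inner_toEuclideanCLM, ← b.sum_inner_mul_inner]
    refine Finset.sum_congr rfl fun i _ => ?_
    have h1 : inner ℝ (b i) (Matrix.toEuclideanCLM (𝕜 := ℝ) H (∑ i, x i • b i)) = η i * x i := by
      have hHT : H.transpose = H := by simpa [Matrix.IsHermitian] using hH
      rw [Matrix.inner_toEuclideanCLM, Matrix.dotProduct_mulVec, ← Matrix.mulVec_transpose, hHT,
        hH.mulVec_eigenvectorBasis, smul_dotProduct, smul_eq_mul]
      congr 1
      rw [← hx i, EuclideanSpace.inner_eq_star_dotProduct, star_trivial, dotProduct_comm]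
    rw [h1, real_inner_comm, hx]
    ring
  have hnorm : ∀ x : Fin n → ℝ, ‖∑ i, x i • b i‖ ^ 2 = ∑ i, x i ^ 2 := by
    intro x
    have hx : ∀ i, inner ℝ (b i) (∑ i, x i • b i) = x i := fun i => by
      simp [inner_sum, inner_smul_right, b.inner_eq_ite]
    rw [← b.sum_sq_inner_right]
    simp_rw [hx]
  have hm : MeasurableSet {g : EuclideanSpace ℝ (Fin n) |
      ε * ‖g‖ ^ 2 ≤ |g.ofLp ⬝ᵥ H.mulVec g.ofLp - r * ‖g‖ ^ 2|} := by
    have h1 : ∀ g : EuclideanSpace ℝ (Fin n), g.ofLp ⬝ᵥ H.mulVec g.ofLp =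
        inner ℝ g (Matrix.toEuclideanCLM (𝕜 := ℝ) H g) :=
      fun g => (Matrix.inner_toEuclideanCLM _ _ _).symm
    simp_rw [h1]
    exact measurableSet_le (by fun_prop) (by fun_prop)
  rw [stdGaussian_eq_map_pi_orthonormalBasis b, Measure.map_apply (by fun_prop) hm]
  have hsub : (fun x : Fin n → ℝ => ∑ i, x i • b i) ⁻¹' {g : EuclideanSpace ℝ (Fin n) |
      ε * ‖g‖ ^ 2 ≤ |g.ofLp ⬝ᵥ H.mulVec g.ofLp - r * ‖g‖ ^ 2|} ⊆
      {x | 0 ≤ ∑ i, (η i - r - ε) * x i ^ 2} ∪ {x | 0 ≤ ∑ i, (r - ε - η i) * x i ^ 2} := by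
    intro x hx
    rw [Set.mem_preimage, Set.mem_ofPred_eq, hquad, hnorm] at hx
    rcases le_abs.mp hx with h | h
    · left
      simp only [Set.mem_ofPred_eq, sub_mul, Finset.sum_sub_distrib, ← Finset.mul_sum]
      linarith
    · right
      simp only [Set.mem_ofPred_eq, sub_mul, Finset.sum_sub_distrib, ← Finset.mul_sum]
      linarith
  refine (measure_mono hsub).trans ((measure_union_le _ _).trans ?_)
  rw [two_mul, ENNReal.ofReal_add (Real.exp_pos _).le (Real.exp_pos _).le]
  refine add_le_add (pi_gaussian_measure_nonneg_le hε hε1 (fun i => ?_) ?_)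
    (pi_gaussian_measure_nonneg_le hε hε1 (fun i => ?_) ?_)
  · rw [abs_le]
    rcases hη i with h | h <;> rw [h] <;> constructor <;> linarith
  · simp [Finset.sum_sub_distrib, hηsum]
  · rw [abs_le]
    rcases hη i with h | h <;> rw [h] <;> constructor <;> linarith
  · simp [Finset.sum_sub_distrib, hηsum]

end Quadratic

/-! ### The hat matrix and concentration of its diagonal -/

section Hat

variable {F : Type*} [NormedAddCommGroup F] [InnerProductSpace ℝ F] {p : ℕ}

/-- The bilinear form of the orthogonal projection onto the span of `c`. -/
noncomputable def hatForm (c : Fin p → F) (g h : F) : ℝ :=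
  (fun a => inner ℝ (c a) g) ⬝ᵥ (Matrix.gram ℝ c)⁻¹.mulVec fun a => inner ℝ (c a) h

theorem hatForm_map (f : F ≃ₗᵢ[ℝ] F) (c : Fin p → F) (g h : F) :
    hatForm (fun a => f (c a)) (f g) (f h) = hatForm c g h := by
  have : Matrix.gram ℝ (fun a => f (c a)) = Matrix.gram ℝ c := by
    ext a b
    simp [Matrix.gram_apply]
  simp [hatForm, this]

theorem hatForm_smul_left (c : Fin p → F) (r : ℝ) (g h : F) :
    hatForm c (r • g) h = r * hatForm c g h := by
  simp only [hatForm, inner_smul_right]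
  exact smul_dotProduct r _ _

theorem hatForm_smul_right (c : Fin p → F) (r : ℝ) (g h : F) :
    hatForm c g (r • h) = r * hatForm c g h := by
  simp only [hatForm, inner_smul_right]
  have : (fun a => r * inner ℝ (c a) h) = r • fun a => inner ℝ (c a) h := rfl
  rw [this, Matrix.mulVec_smul, dotProduct_smul, smul_eq_mul]

theorem measurable_matrix_inv {α : Type*} [MeasurableSpace α] {M : α → Matrix (Fin p) (Fin p) ℝ}
    (hM : ∀ a b, Measurable fun x => M x a b) (a b : Fin p) :
    Measurable fun x => (M x)⁻¹ a b := by
  have hdet : ∀ N : α → Matrix (Fin p) (Fin p) ℝ, (∀ a b, Measurable fun x => N x a b) →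
      Measurable fun x => (N x).det := by
    intro N hN
    simp_rw [Matrix.det_apply]
    refine Finset.measurable_sum _ fun σ _ => Measurable.const_smul ?_ _
    exact Finset.measurable_prod _ fun i _ => hN _ _
  simp_rw [Matrix.inv_def, Matrix.smul_apply, Ring.inverse_eq_inv', smul_eq_mul,
    Matrix.adjugate_apply]
  refine (hdet M hM).inv.mul (hdet _ fun i j => ?_)
  simp_rw [Matrix.updateRow_apply]
  split_ifs
  · exact measurable_const
  · exact hM _ _

theorem measurable_hatForm [FiniteDimensional ℝ F] [MeasurableSpace F] [BorelSpace F] {α : Type*}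
    [MeasurableSpace α] {c : α → Fin p → F} {g h : α → F} (hc : Measurable c) (hg : Measurable g)
    (hh : Measurable h) : Measurable fun x => hatForm (c x) (g x) (h x) := by
  have hca : ∀ a, Measurable fun x => c x a := fun a => (measurable_pi_apply a).comp hc
  simp only [hatForm, dotProduct, Matrix.mulVec]
  refine Finset.measurable_sum _ fun a _ => Measurable.mul ((hca a).inner hg) ?_
  refine Finset.measurable_sum _ fun b _ => Measurable.mul ?_ ((hca b).inner hh)
  refine measurable_matrix_inv (fun a b => ?_) a b
  simp_rw [Matrix.gram_apply]
  exact (hca a).inner (hca b)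

theorem exists_isometry_map_eq {v w : F} (h : ‖v‖ = ‖w‖) : ∃ f : F ≃ₗᵢ[ℝ] F, f v = w :=
  ⟨_, Submodule.reflection_sub h⟩

theorem measurePreserving_pi_isometry [FiniteDimensional ℝ F] [MeasurableSpace F] [BorelSpace F]
    (f : F ≃ₗᵢ[ℝ] F) :
    MeasurePreserving (fun (c : Fin p → F) a => f (c a)) (Measure.pi fun _ => stdGaussian F)
      (Measure.pi fun _ => stdGaussian F) :=
  measurePreserving_pi _ _ fun _ => ⟨f.continuous.measurable, stdGaussian_map f⟩

end Hat

section HatMatrix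

variable {n p : ℕ}

/-- The matrix of the orthogonal projection onto the span of `c`. -/
noncomputable def hatMatrix (c : Fin p → EuclideanSpace ℝ (Fin n)) : Matrix (Fin n) (Fin n) ℝ :=
  (Matrix.of fun i a => c a i) * (Matrix.gram ℝ c)⁻¹ * (Matrix.of fun i a => c a i).transpose

theorem gram_eq_transpose_mul (c : Fin p → EuclideanSpace ℝ (Fin n)) :
    Matrix.gram ℝ c = (Matrix.of fun i a => c a i).transpose * (Matrix.of fun i a => c a i) := by
  ext a b
  simp [Matrix.gram_apply, Matrix.mul_apply, PiLp.inner_apply, mul_comm]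

theorem hatForm_self (c : Fin p → EuclideanSpace ℝ (Fin n)) (g : EuclideanSpace ℝ (Fin n)) :
    hatForm c g g = g.ofLp ⬝ᵥ (hatMatrix c).mulVec g.ofLp := by
  have h1 : (fun a => inner ℝ (c a) g) =
      (Matrix.of fun i a => c a i : Matrix (Fin n) (Fin p) ℝ).transpose.mulVec g.ofLp := by
    ext a
    simp [Matrix.mulVec, dotProduct, PiLp.inner_apply, mul_comm]
  rw [hatForm, h1, hatMatrix, ← Matrix.mulVec_mulVec, ← Matrix.mulVec_mulVec,
    Matrix.dotProduct_mulVec g.ofLp, ← Matrix.mulVec_transpose]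

theorem hatMatrix_isHermitian (c : Fin p → EuclideanSpace ℝ (Fin n)) :
    (hatMatrix c).IsHermitian := by
  have h : (Matrix.gram ℝ c).transpose = Matrix.gram ℝ c := by
    ext a b
    simp [Matrix.gram_apply, real_inner_comm]
  rw [Matrix.IsHermitian, Matrix.conjTranspose_eq_transpose_of_trivial, hatMatrix,
    Matrix.transpose_mul, Matrix.transpose_mul, Matrix.transpose_transpose,
    Matrix.transpose_nonsing_inv, h, Matrix.mul_assoc]

variable {c : Fin p → EuclideanSpace ℝ (Fin n)}

theorem isUnit_det_gram (hc : LinearIndependent ℝ c) : IsUnit (Matrix.gram ℝ c).det :=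
  isUnit_iff_ne_zero.mpr (Matrix.det_gram_ne_zero_iff_linearIndependent.mpr hc)

theorem hatMatrix_mul_self (hc : LinearIndependent ℝ c) : hatMatrix c * hatMatrix c = hatMatrix c := by
  set Z : Matrix (Fin n) (Fin p) ℝ := Matrix.of fun i a => c a i with hZ
  have h : hatMatrix c = Z * (Matrix.gram ℝ c)⁻¹ * Z.transpose := rfl
  calc hatMatrix c * hatMatrix c
      = Z * (Matrix.gram ℝ c)⁻¹ * (Z.transpose * Z) * (Matrix.gram ℝ c)⁻¹ * Z.transpose := by
        rw [h]
        simp only [Matrix.mul_assoc]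
    _ = hatMatrix c := by
        rw [hZ, ← gram_eq_transpose_mul, Matrix.nonsing_inv_mul_cancel_right _ _ (isUnit_det_gram hc)]
        rfl

theorem trace_hatMatrix (hc : LinearIndependent ℝ c) : (hatMatrix c).trace = p := by
  rw [hatMatrix, Matrix.trace_mul_comm, ← Matrix.mul_assoc, ← gram_eq_transpose_mul,
    Matrix.mul_nonsing_inv _ (isUnit_det_gram hc)]
  simp

/-- By rotation invariance of the columns, the fixed unit vector `e` may be replaced by the
direction of an independent Gaussian `g`. Conditionally on the columns, the hat matrix is then a
fixed projection of trace `p`. -/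
theorem measure_leverage_dev_le (hn : 0 < n) (hpn : p ≤ n) {ε : ℝ} (hε : 0 < ε) (hε1 : ε ≤ 1)
    {e : EuclideanSpace ℝ (Fin n)} (he : ‖e‖ = 1) :
    (Measure.pi fun _ : Fin p => stdGaussian (EuclideanSpace ℝ (Fin n)))
      {c | ε ≤ |hatForm c e e - p / n|} ≤ ENNReal.ofReal (2 * Real.exp (-(n * ε ^ 2 / 32))) := by
  set μ := Measure.pi fun _ : Fin p => stdGaussian (EuclideanSpace ℝ (Fin n))
  have hn' : (0 : ℝ) < n := by exact_mod_cast hn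
  have hpn' : (p : ℝ) / n ≤ 1 := (div_le_one hn').mpr (by exact_mod_cast hpn)
  let A : Set ((Fin p → EuclideanSpace ℝ (Fin n)) × EuclideanSpace ℝ (Fin n)) :=
    {q | ε * ‖q.2‖ ^ 2 ≤ |hatForm q.1 q.2 q.2 - p / n * ‖q.2‖ ^ 2|}
  have hA : MeasurableSet A := by
    refine measurableSet_le (by fun_prop) ?_
    exact ((measurable_hatForm measurable_fst measurable_snd measurable_snd).sub
      (by fun_prop)).norm
  have hsec : ∀ g, μ {c | ε ≤ |hatForm c e e - p / n|} ≤ μ {c | (c, g) ∈ A} := by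
    intro g
    obtain ⟨f, hf⟩ := exists_isometry_map_eq (v := g) (w := ‖g‖ • e) (by rw [norm_smul, he]; simp)
    have hm : MeasurableSet {c : Fin p → EuclideanSpace ℝ (Fin n) | ε ≤ |hatForm c e e - p / n|} :=
      measurableSet_le measurable_const
        ((measurable_hatForm measurable_id measurable_const measurable_const).sub_const _).norm
    rw [← (measurePreserving_pi_isometry f).measure_preimage hm.nullMeasurableSet]
    refine measure_mono fun c hc => ?_
    change ε ≤ |hatForm (fun a => f (c a)) e e - p / n| at hc
    change ε * ‖g‖ ^ 2 ≤ |hatForm c g g - p / n * ‖g‖ ^ 2|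
    rw [← hatForm_map f, hf, hatForm_smul_left, hatForm_smul_right]
    have : ‖g‖ * (‖g‖ * hatForm (fun a => f (c a)) e e) - p / n * ‖g‖ ^ 2 =
        (hatForm (fun a => f (c a)) e e - p / n) * ‖g‖ ^ 2 := by ring
    rw [this, abs_mul, abs_of_nonneg (sq_nonneg ‖g‖)]
    gcongr
  calc μ {c | ε ≤ |hatForm c e e - p / n|}
      = ∫⁻ _g, μ {c | ε ≤ |hatForm c e e - p / n|} ∂stdGaussian (EuclideanSpace ℝ (Fin n)) := by simp
    _ ≤ ∫⁻ g, μ {c | (c, g) ∈ A} ∂stdGaussian (EuclideanSpace ℝ (Fin n)) := lintegral_mono hsec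
    _ = (μ.prod (stdGaussian (EuclideanSpace ℝ (Fin n)))) A := (Measure.prod_apply_symm hA).symm
    _ = ∫⁻ c, stdGaussian (EuclideanSpace ℝ (Fin n)) {g | (c, g) ∈ A} ∂μ := Measure.prod_apply hA
    _ ≤ ∫⁻ _c, ENNReal.ofReal (2 * Real.exp (-(n * ε ^ 2 / 32))) ∂μ := by
        refine lintegral_mono_ae ?_
        filter_upwards [ae_linearIndependent_stdGaussian (F := EuclideanSpace ℝ (Fin n)) (p := p)
          (by simpa using hpn)] with c hc
        have := stdGaussian_projection_le hε hε1 (by positivity) hpn' (hatMatrix_isHermitian c)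
          (hatMatrix_mul_self hc) (by rw [trace_hatMatrix hc]; field_simp)
        simp_rw [← hatForm_self] at this
        exact this
    _ = _ := by simp

end HatMatrix

/-! ### Directions invariant under the isometries fixing a vector -/

section Direction

variable {F : Type*} [NormedAddCommGroup F] [InnerProductSpace ℝ F]

theorem exists_isometry_fixing {e v w : F} (h : ‖v‖ = ‖w‖) (hv : inner ℝ e v = 0)
    (hw : inner ℝ e w = 0) : ∃ f : F ≃ₗᵢ[ℝ] F, f v = w ∧ f e = e := by
  refine ⟨_, Submodule.reflection_sub h, Submodule.reflection_mem_subspace_eq_self ?_⟩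
  rw [Submodule.mem_orthogonal_singleton_iff_inner_left, inner_sub_right, hv, hw, sub_zero]

/-- The orthogonal projection of `e` onto the span of `c`, minus its component along `e`. -/
noncomputable def residual {p : ℕ} (e : F) (c : Fin p → F) : F :=
  (∑ a, (Matrix.gram ℝ c)⁻¹.mulVec (fun b => inner ℝ (c b) e) a • c a) - hatForm c e e • e

theorem inner_residual {p : ℕ} (e h : F) (c : Fin p → F) :
    inner ℝ h (residual e c) = hatForm c h e - hatForm c e e * inner ℝ h e := by
  rw [residual, inner_sub_right, inner_smul_right, inner_sum]
  congr 1
  simp only [hatForm, dotProduct, inner_smul_right]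
  exact Finset.sum_congr rfl fun a _ => by rw [real_inner_comm, mul_comm]

variable [FiniteDimensional ℝ F] [MeasurableSpace F] [BorelSpace F]

/-- By invariance the characteristic function of `ρ₁` at `ξ` depends only on the norm of the part of
`ξ` orthogonal to `e`, so it may be evaluated along any unit `θ' ⊥ e` and averaged over `ρ₂`. The
resulting double integral is symmetric in the two measures. -/
theorem charFun_mul_eq_integral {e : F} (he : ‖e‖ = 1) {ρ₁ ρ₂ : Measure F} [IsFiniteMeasure ρ₁]
    [IsFiniteMeasure ρ₂] (h₁ : ∀ᵐ θ ∂ρ₁, inner ℝ e θ = 0)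
    (h₂ : ∀ᵐ θ ∂ρ₂, ‖θ‖ = 1 ∧ inner ℝ e θ = 0)
    (inv₁ : ∀ f : F ≃ₗᵢ[ℝ] F, f e = e → ρ₁.map f = ρ₁) (ξ : F) :
    charFun ρ₁ ξ * ρ₂.real Set.univ =
      ∫ θ', ∫ θ, Complex.exp (inner ℝ θ (‖ξ - inner ℝ e ξ • e‖ • θ') * Complex.I) ∂ρ₁ ∂ρ₂ := by
  set ξ' := ξ - inner ℝ e ξ • e with hξ'
  have hperp : inner ℝ e ξ' = 0 := by
    rw [hξ', inner_sub_right, inner_smul_right, real_inner_self_eq_norm_sq, he]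
    ring
  have hproj : charFun ρ₁ ξ = charFun ρ₁ ξ' := by
    rw [charFun_apply, charFun_apply]
    refine integral_congr_ae ?_
    filter_upwards [h₁] with θ hθ
    rw [hξ', inner_sub_right, inner_smul_right, real_inner_comm, real_inner_comm θ] at *
    simp [hθ]
  have hconst : ∀ᵐ θ' ∂ρ₂, ∫ θ, Complex.exp (inner ℝ θ (‖ξ'‖ • θ') * Complex.I) ∂ρ₁ =
      charFun ρ₁ ξ := by
    filter_upwards [h₂] with θ' hθ'
    obtain ⟨f, hf, hfe⟩ := exists_isometry_fixing (e := e) (v := ξ') (w := ‖ξ'‖ • θ')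
      (by rw [norm_smul, hθ'.1]; simp) hperp (by rw [inner_smul_right, hθ'.2, mul_zero])
    rw [hproj, ← charFun_apply, ← hf]
    conv_lhs => rw [← inv₁ f hfe]
    rw [charFun_apply, charFun_apply, integral_map f.continuous.aemeasurable (by fun_prop)]
    simp
  rw [integral_congr_ae hconst, integral_const, Complex.real_smul, mul_comm]

/-- Uniqueness, up to mass, of the invariant measure on the unit sphere of `e⊥`, from the symmetry
of the double integral in `charFun_mul_eq_integral`. -/
theorem smul_eq_smul_of_map_isometry_eq {e : F} (he : ‖e‖ = 1) {ρ₁ ρ₂ : Measure F}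
    [IsFiniteMeasure ρ₁] [IsFiniteMeasure ρ₂] (h₁ : ∀ᵐ θ ∂ρ₁, ‖θ‖ = 1 ∧ inner ℝ e θ = 0)
    (h₂ : ∀ᵐ θ ∂ρ₂, ‖θ‖ = 1 ∧ inner ℝ e θ = 0)
    (inv₁ : ∀ f : F ≃ₗᵢ[ℝ] F, f e = e → ρ₁.map f = ρ₁)
    (inv₂ : ∀ f : F ≃ₗᵢ[ℝ] F, f e = e → ρ₂.map f = ρ₂) :
    ρ₂ Set.univ • ρ₁ = ρ₁ Set.univ • ρ₂ := by
  have hf1 : IsFiniteMeasure (ρ₂ Set.univ • ρ₁) := ⟨by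
    rw [Measure.smul_apply, smul_eq_mul]
    exact ENNReal.mul_lt_top (measure_lt_top _ _) (measure_lt_top _ _)⟩
  have hf2 : IsFiniteMeasure (ρ₁ Set.univ • ρ₂) := ⟨by
    rw [Measure.smul_apply, smul_eq_mul]
    exact ENNReal.mul_lt_top (measure_lt_top _ _) (measure_lt_top _ _)⟩
  apply Measure.ext_of_charFun
  ext ξ
  have e1 := charFun_mul_eq_integral he (h₁.mono fun _ h => h.2) h₂ inv₁ ξ
  have e2 := charFun_mul_eq_integral he (h₂.mono fun _ h => h.2) h₁ inv₂ ξ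
  have hint : Integrable (Function.uncurry fun θ' θ : F =>
      Complex.exp (inner ℝ θ (‖ξ - inner ℝ e ξ • e‖ • θ') * Complex.I)) (ρ₂.prod ρ₁) := by
    refine Integrable.of_bound (C := 1) ?_ (ae_of_all _ fun q => ?_)
    · refine Continuous.aestronglyMeasurable ?_
      simp only [Function.uncurry_def]
      fun_prop
    · simp only [Function.uncurry]
      rw [Complex.norm_exp_ofReal_mul_I]
  rw [integral_integral_swap hint] at e1
  have hsymm : ∀ θ θ' : F, inner ℝ θ (‖ξ - inner ℝ e ξ • e‖ • θ') =
      inner ℝ θ' (‖ξ - inner ℝ e ξ • e‖ • θ) := fun θ θ' => by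
    rw [inner_smul_right, inner_smul_right, real_inner_comm θ θ']
  have e3 : charFun ρ₁ ξ * ρ₂.real Set.univ = charFun ρ₂ ξ * ρ₁.real Set.univ := by
    rw [e1, e2]
    exact integral_congr_ae (ae_of_all _ fun θ => integral_congr_ae (ae_of_all _ fun θ' => by
      simp only [hsymm θ θ']))
  rw [charFun_apply, charFun_apply, integral_smul_measure, integral_smul_measure,
    ← charFun_apply, ← charFun_apply]
  change ρ₂.real Set.univ • charFun ρ₁ ξ = ρ₁.real Set.univ • charFun ρ₂ ξ
  rw [Complex.real_smul, Complex.real_smul, mul_comm, e3, mul_comm]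

/-- The random vector `v` is orthogonal to `e`, and its law is invariant under the isometries
fixing `e`. -/
structure EquivariantVector {X : Type*} [MeasurableSpace X] (e : F) (μ : Measure X) (v : X → F) :
    Prop where
  measurable : Measurable v
  inner_eq_zero : ∀ x, inner ℝ e (v x) = 0
  exists_map : ∀ f : F ≃ₗᵢ[ℝ] F, f e = e →
    ∃ Φ : X → X, MeasurePreserving Φ μ μ ∧ ∀ x, v (Φ x) = f (v x)

/-- The law of the direction of `v`, on the event `v ≠ 0`. -/
noncomputable def directionLaw {X : Type*} [MeasurableSpace X] (μ : Measure X) (v : X → F) :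
    Measure F :=
  (μ.restrict {x | v x ≠ 0}).map fun x => ‖v x‖⁻¹ • v x

section Law

variable {X : Type*} [MeasurableSpace X] {e : F} {μ : Measure X} {v : X → F}

theorem EquivariantVector.measurableSet_ne (hv : EquivariantVector e μ v) :
    MeasurableSet {x | v x ≠ 0} :=
  (hv.measurable (measurableSet_singleton 0)).compl

theorem EquivariantVector.measurable_direction (hv : EquivariantVector e μ v) :
    Measurable fun x => ‖v x‖⁻¹ • v x :=
  hv.measurable.norm.inv.smul hv.measurable

theorem EquivariantVector.directionLaw_apply (hv : EquivariantVector e μ v) {B : Set F}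
    (hB : MeasurableSet B) :
    directionLaw μ v B = μ {x | v x ≠ 0 ∧ ‖v x‖⁻¹ • v x ∈ B} := by
  rw [directionLaw, Measure.map_apply hv.measurable_direction hB,
    Measure.restrict_apply (hv.measurable_direction hB), Set.inter_comm]
  rfl

theorem EquivariantVector.ae_directionLaw (hv : EquivariantVector e μ v) :
    ∀ᵐ θ ∂directionLaw μ v, ‖θ‖ = 1 ∧ inner ℝ e θ = 0 := by
  have hm : MeasurableSet {θ : F | ‖θ‖ = 1 ∧ inner ℝ e θ = 0} :=
    (measurableSet_eq_fun (by fun_prop) (by fun_prop)).inter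
      (measurableSet_eq_fun (by fun_prop) (by fun_prop))
  rw [directionLaw, ae_map_iff hv.measurable_direction.aemeasurable hm,
    ae_restrict_iff' hv.measurableSet_ne]
  refine ae_of_all _ fun x hx => ⟨?_, ?_⟩
  · rw [norm_smul, norm_inv, norm_norm, inv_mul_cancel₀ (norm_ne_zero_iff.mpr hx)]
  · rw [inner_smul_right, hv.inner_eq_zero, mul_zero]

theorem EquivariantVector.map_directionLaw (hv : EquivariantVector e μ v) (f : F ≃ₗᵢ[ℝ] F)
    (hf : f e = e) : (directionLaw μ v).map f = directionLaw μ v := by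
  obtain ⟨Φ, hΦ, hΦv⟩ := hv.exists_map f hf
  have hpre : Φ ⁻¹' {x | v x ≠ 0} = {x | v x ≠ 0} := by
    ext x
    simp [hΦv]
  have h1 := hΦ.restrict_preimage hv.measurableSet_ne
  rw [hpre] at h1
  rw [directionLaw, Measure.map_map f.continuous.measurable hv.measurable_direction]
  conv_rhs => rw [← h1.map_eq, Measure.map_map hv.measurable_direction h1.measurable]
  congr 1
  ext x
  simp [hΦv]

/-- Both directions have the same law up to mass, and a cone event only sees the direction. The
possible vanishing of `v` only lowers the left side. -/
theorem EquivariantVector.measure_cone_le (he : ‖e‖ = 1) [IsProbabilityMeasure μ]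
    (hv : EquivariantVector e μ v) {X' : Type*} [MeasurableSpace X'] {μ' : Measure X'}
    [IsProbabilityMeasure μ'] {v' : X' → F} (hv' : EquivariantVector e μ' v')
    (hne : ∀ᵐ x ∂μ', v' x ≠ 0) {B : Set F} (hB : MeasurableSet B)
    (hcone : ∀ z : F, z ≠ 0 → (‖z‖⁻¹ • z ∈ B ↔ z ∈ B)) :
    μ {x | v x ≠ 0 ∧ v x ∈ B} ≤ μ' {x | v' x ∈ B} := by
  have hfin : IsFiniteMeasure (directionLaw μ v) := by
    unfold directionLaw
    infer_instance
  have hfin' : IsFiniteMeasure (directionLaw μ' v') := by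
    unfold directionLaw
    infer_instance
  have h := smul_eq_smul_of_map_isometry_eq he hv.ae_directionLaw hv'.ae_directionLaw
    hv.map_directionLaw hv'.map_directionLaw
  have h1 := congrArg (fun ρ : Measure F => ρ B) h
  simp only [Measure.smul_apply, smul_eq_mul, hv.directionLaw_apply hB, hv'.directionLaw_apply hB,
    hv.directionLaw_apply MeasurableSet.univ, hv'.directionLaw_apply MeasurableSet.univ,
    Set.mem_univ, and_true] at h1
  have h2 : μ' {x | v' x ≠ 0} = 1 := prob_compl_eq_zero_iff hv'.measurableSet_ne |>.mp hne
  have h3 : {x | v x ≠ 0 ∧ ‖v x‖⁻¹ • v x ∈ B} = {x | v x ≠ 0 ∧ v x ∈ B} := by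
    ext x
    exact and_congr_right fun hx => hcone _ hx
  have h4 : {x | v' x ≠ 0 ∧ ‖v' x‖⁻¹ • v' x ∈ B} = {x | v' x ≠ 0 ∧ v' x ∈ B} := by
    ext x
    exact and_congr_right fun hx => hcone _ hx
  rw [h2, one_mul, h3, h4] at h1
  rw [h1]
  calc _ ≤ 1 * μ' {x | v' x ≠ 0 ∧ v' x ∈ B} := by
        gcongr
        exact prob_le_one
    _ ≤ _ := by
        rw [one_mul]
        exact measure_mono fun x hx => hx.2

end Law

/-- Rotating all columns by an isometry fixing `e` preserves their law and rotates the residual;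
equivariance is tested against inner products, where it is `hatForm_map`. -/
theorem equivariantVector_residual {p : ℕ} {e : F} (he : ‖e‖ = 1) :
    EquivariantVector e (Measure.pi fun _ : Fin p => stdGaussian F) (residual e) := by
  refine ⟨?_, fun c => ?_, fun f hf => ⟨_, measurePreserving_pi_isometry f, fun c => ?_⟩⟩
  · refine Measurable.sub (Finset.measurable_sum _ fun a _ => Measurable.smul ?_ (by fun_prop))
      ((measurable_hatForm measurable_id measurable_const measurable_const).smul_const e)
    simp only [Matrix.mulVec, dotProduct]
    refine Finset.measurable_sum _ fun b _ => Measurable.mul ?_ (by fun_prop)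
    refine measurable_matrix_inv (fun a b => ?_) a b
    simp only [Matrix.gram_apply]
    fun_prop
  · rw [inner_residual, real_inner_self_eq_norm_sq, he]
    ring
  · refine ext_inner_left ℝ fun h => ?_
    have h1 : inner ℝ h (f (residual e c)) = inner ℝ (f.symm h) (residual e c) := by
      rw [← f.inner_map_map (f.symm h), f.apply_symm_apply]
    rw [h1, inner_residual, inner_residual]
    have h2 := hatForm_map f c (f.symm h) e
    have h3 := hatForm_map f c e e
    have h4 := f.inner_map_map (f.symm h) e
    rw [f.apply_symm_apply, hf] at h2 h4
    rw [hf] at h3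
    rw [h2, h3, h4]

theorem equivariantVector_sub_inner {e : F} (he : ‖e‖ = 1) :
    EquivariantVector e (stdGaussian F) fun g => g - inner ℝ e g • e := by
  refine ⟨by fun_prop, fun g => ?_, fun f hf => ⟨f, ⟨f.continuous.measurable, stdGaussian_map f⟩,
    fun g => ?_⟩⟩
  · rw [inner_sub_right, inner_smul_right, real_inner_self_eq_norm_sq, he]
    ring
  · have : inner ℝ e (f g) = inner ℝ e g := by
      conv_lhs => rw [← hf]
      rw [f.inner_map_map]
    rw [this, map_sub, map_smul, hf]

end Direction

/-! ### Few small entries in a row of the hat matrix -/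

section Spread

variable {n p : ℕ}

open Classical in
/-- The coordinates `j ≠ i` in which `v` is small compared with its norm. -/
noncomputable def smallCoords (i : Fin n) (v : EuclideanSpace ℝ (Fin n)) : Finset (Fin n) :=
  Finset.univ.filter fun j => j ≠ i ∧ v j ^ 2 < ‖v‖ ^ 2 / (1600 * n)

theorem measurable_card_smallCoords (i : Fin n) :
    Measurable fun v : EuclideanSpace ℝ (Fin n) => ((smallCoords i v).card : ℝ) := by
  classical
  simp only [smallCoords, Finset.card_filter, Nat.cast_sum]
  refine Finset.measurable_sum _ fun j _ => ?_
  simp only [Nat.cast_ite, Nat.cast_one, Nat.cast_zero]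
  refine Measurable.ite ?_ measurable_const measurable_const
  refine MeasurableSet.inter (MeasurableSet.const _) ?_
  have h1 : Measurable fun v : EuclideanSpace ℝ (Fin n) => v j ^ 2 := by fun_prop
  have h2 : Measurable fun v : EuclideanSpace ℝ (Fin n) => ‖v‖ ^ 2 / (1600 * n) := by fun_prop
  exact measurableSet_lt h1 h2

theorem smallCoords_smul (i : Fin n) {r : ℝ} (hr : r ≠ 0) (v : EuclideanSpace ℝ (Fin n)) :
    smallCoords i (r • v) = smallCoords i v := by
  unfold smallCoords
  congr 1
  ext j
  refine and_congr_right fun _ => ?_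
  have hr2 : 0 < r ^ 2 := by positivity
  rw [norm_smul, mul_pow, Real.norm_eq_abs, sq_abs, PiLp.smul_apply, smul_eq_mul, mul_pow,
    mul_div_assoc, mul_lt_mul_iff_right₀ hr2]

/-- If `‖g‖² < 4n`, a small coordinate satisfies `gⱼ² < 4n / (1600 n) = (1/20)²`. So either `‖g‖² ≥
4n` or at least `n / 5` coordinates are below `1/20`, and Chernoff bounds both events. -/
theorem stdGaussian_smallCoords_le (i : Fin n) :
    stdGaussian (EuclideanSpace ℝ (Fin n))
      {g | (n : ℝ) / 5 ≤ (smallCoords i (g - inner ℝ (EuclideanSpace.single i (1 : ℝ)) g •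
        EuclideanSpace.single i 1)).card} ≤ ENNReal.ofReal (2 * Real.exp (-(n / 10))) := by
  classical
  set e : EuclideanSpace ℝ (Fin n) := EuclideanSpace.single i 1 with he
  have hn : (0 : ℝ) < n := by
    have := i.pos
    exact_mod_cast this
  have hm : MeasurableSet {g | (n : ℝ) / 5 ≤ (smallCoords i (g - inner ℝ e g • e)).card} :=
    measurableSet_le measurable_const ((measurable_card_smallCoords i).comp (by fun_prop))
  rw [← map_pi_eq_stdGaussian, Measure.map_apply (by fun_prop) hm]
  have h1 := pi_measure_le_sum_le (fun _ : Fin n => gaussianReal 0 1)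
    (f := fun _ t => 1 / 4 * t ^ 2) (fun _ => by fun_prop)
    (fun _ => lintegral_exp_sq_gaussianReal_le (by norm_num [abs_of_pos])) n
  have h2 := pi_measure_le_sum_le (fun _ : Fin n => gaussianReal 0 1)
    (f := fun _ t => if |t| < 1 / 20 then 1 else 0)
    (fun _ => Measurable.ite (measurableSet_lt (by fun_prop) measurable_const) measurable_const
      measurable_const) (fun _ => lintegral_exp_indicator_gaussianReal_le) (n / 5)
  have hsub : (WithLp.toLp 2) ⁻¹' {g | (n : ℝ) / 5 ≤ (smallCoords i (g - inner ℝ e g • e)).card} ⊆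
      {x : Fin n → ℝ | (n : ℝ) ≤ ∑ i, 1 / 4 * x i ^ 2} ∪
        {x | (n : ℝ) / 5 ≤ ∑ i, if |x i| < 1 / 20 then 1 else 0} := by
    intro x hx
    by_cases hx1 : (n : ℝ) ≤ ∑ i, 1 / 4 * x i ^ 2
    · exact Or.inl hx1
    · right
      rw [← Finset.mul_sum] at hx1
      refine le_trans (show (n : ℝ) / 5 ≤ _ from hx) ?_
      rw [smallCoords, Finset.card_filter, Nat.cast_sum]
      refine Finset.sum_le_sum fun j _ => ?_
      by_cases hj : |x j| < 1 / 20
      · rw [if_pos hj]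
        split_ifs <;> simp
      · rw [if_neg hj, if_neg]
        · simp
        rintro ⟨hji, hlt⟩
        set g : EuclideanSpace ℝ (Fin n) := WithLp.toLp 2 x with hg
        have hgn : ‖g‖ ^ 2 = ∑ i, x i ^ 2 := by rw [EuclideanSpace.real_norm_sq_eq]
        have hcoord : (g - inner ℝ e g • e) j = x j := by
          simp [he, hg, hji]
        have hle : ‖g - inner ℝ e g • e‖ ^ 2 ≤ ‖g‖ ^ 2 := by
          have hee : ‖e‖ ^ 2 = 1 := by simp [he]
          rw [norm_sub_sq_real, inner_smul_right, norm_smul, mul_pow, hee, Real.norm_eq_abs, sq_abs,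
            real_inner_comm g e]
          nlinarith [sq_nonneg (inner ℝ e g)]
        rw [hcoord, lt_div_iff₀ (by positivity)] at hlt
        push Not at hj hx1
        have h5 : (1 / 20 : ℝ) ^ 2 ≤ x j ^ 2 := by
          rw [← sq_abs (x j)]
          gcongr
        nlinarith
  refine (measure_mono hsub).trans ((measure_union_le _ _).trans ?_)
  rw [two_mul, ENNReal.ofReal_add (Real.exp_pos _).le (Real.exp_pos _).le]
  refine add_le_add (h1.trans ?_) (h2.trans ?_) <;>
  · apply ENNReal.ofReal_le_ofReal
    apply Real.exp_le_exp.mpr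
    simp only [Finset.sum_const, Finset.card_univ, Fintype.card_fin, nsmul_eq_mul]
    linarith

theorem measure_residual_smallCoords_le (hn : 2 ≤ n) (i : Fin n) :
    (Measure.pi fun _ : Fin p => stdGaussian (EuclideanSpace ℝ (Fin n)))
      {c | residual (EuclideanSpace.single i 1) c ≠ 0 ∧
        (n : ℝ) / 5 ≤ (smallCoords i (residual (EuclideanSpace.single i 1) c)).card} ≤
      ENNReal.ofReal (2 * Real.exp (-(n / 10))) := by
  have he : ‖(EuclideanSpace.single i (1 : ℝ) : EuclideanSpace ℝ (Fin n))‖ = 1 := by simp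
  refine ((equivariantVector_residual he).measure_cone_le he (equivariantVector_sub_inner he) ?_
    (B := {v | (n : ℝ) / 5 ≤ (smallCoords i v).card})
    (measurableSet_le measurable_const (measurable_card_smallCoords i)) fun z hz => ?_).trans
    (stdGaussian_smallCoords_le i)
  · have hne : Submodule.span ℝ {(EuclideanSpace.single i (1 : ℝ) : EuclideanSpace ℝ (Fin n))} ≠ ⊤ := by
      intro h
      have h1 := finrank_span_singleton (K := ℝ)
        (v := (EuclideanSpace.single i (1 : ℝ) : EuclideanSpace ℝ (Fin n)))
        (norm_ne_zero_iff.mp (by rw [he]; exact one_ne_zero))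
      rw [h, finrank_top, finrank_euclideanSpace, Fintype.card_fin] at h1
      omega
    rw [ae_iff]
    refine measure_mono_null (fun g hg => ?_) (stdGaussian_submodule_eq_zero hne)
    have hg' := sub_eq_zero.mp (not_not.mp hg)
    exact Submodule.mem_span_singleton.mpr ⟨_, hg'.symm⟩
  · change (n : ℝ) / 5 ≤ _ ↔ (n : ℝ) / 5 ≤ _
    rw [smallCoords_smul i (inv_ne_zero (norm_ne_zero_iff.mpr hz))]

end Spread

/-! ### Mixing for the sample -/

section RowsHat

variable {n p : ℕ}

theorem scatter_rows_one (c : Fin p → EuclideanSpace ℝ (Fin n)) :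
    scatter (rows c) 1 = Matrix.gram ℝ c := by
  ext a b
  simp [scatter, outer, rows, Matrix.sum_apply, Matrix.vecMulVec_apply, Matrix.gram_apply,
    PiLp.inner_apply, mul_comm]

theorem cross_rows_one (c : Fin p → EuclideanSpace ℝ (Fin n)) (i j : Fin n) :
    cross (rows c) 1 i j =
      hatForm c (EuclideanSpace.single j 1) (EuclideanSpace.single i 1) := by
  have h : ∀ k : Fin n, (rows c k).ofLp =
      fun a => inner ℝ (c a) (EuclideanSpace.single k (1 : ℝ)) := by
    intro k
    ext a
    rw [EuclideanSpace.inner_single_right]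
    simp [rows]
  rw [cross, scatter_rows_one, h, h, hatForm]

theorem residual_single_apply (c : Fin p → EuclideanSpace ℝ (Fin n)) (i j : Fin n) :
    residual (EuclideanSpace.single i 1) c j =
      cross (rows c) 1 i j - if j = i then lev (rows c) 1 i else 0 := by
  have h := inner_residual (EuclideanSpace.single i (1 : ℝ)) (EuclideanSpace.single j (1 : ℝ)) c
  rw [lev_eq_cross, cross_rows_one, cross_rows_one]
  rw [EuclideanSpace.inner_single_left] at h
  simp only [map_one, one_mul] at h
  rw [h]
  congr 1
  rw [EuclideanSpace.inner_single_left]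
  simp [PiLp.single_apply]

/-- A row of a projection has squared norm equal to its diagonal entry; removing that entry leaves
`h - h²`. -/
theorem norm_residual_single_sq {c : Fin p → EuclideanSpace ℝ (Fin n)}
    (hc : LinearIndependent ℝ c) (i : Fin n) :
    ‖residual (EuclideanSpace.single i 1) c‖ ^ 2 =
      lev (rows c) 1 i - lev (rows c) 1 i ^ 2 := by
  have hS : (scatter (rows c) 1).PosDef := by
    rw [scatter_rows_one]
    exact Matrix.posDef_gram_iff_linearIndependent.mpr hc
  rw [EuclideanSpace.real_norm_sq_eq]
  simp_rw [residual_single_apply, sub_sq, Finset.sum_add_distrib, Finset.sum_sub_distrib,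
    sum_cross_sq hS]
  simp [← lev_eq_cross]
  ring

/-- Each row discards at most `n / 5 + 1` indices, its own included, and `2 (n / 5 + 1) ≤ n / 2`
once `n ≥ 20`. -/
theorem mixing_rows (hn : 20 ≤ n) {c : Fin p → EuclideanSpace ℝ (Fin n)}
    (hc : LinearIndependent ℝ c) {κ : ℝ} (hκ : 0 < κ)
    (hlev : ∀ i, κ ≤ lev (rows c) 1 i - lev (rows c) 1 i ^ 2)
    (hsmall : ∀ i, ¬(residual (EuclideanSpace.single i 1) c ≠ 0 ∧
      (n : ℝ) / 5 ≤ (smallCoords i (residual (EuclideanSpace.single i 1) c)).card)) :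
    Mixing (rows c) (κ / 1600) := by
  classical
  intro i k
  have hn' : (20 : ℝ) ≤ n := by exact_mod_cast hn
  let A : Fin n → Finset (Fin n) := fun l =>
    insert l (smallCoords l (residual (EuclideanSpace.single l 1) c))
  have hA : ∀ l, ((A l).card : ℝ) ≤ n / 5 + 1 := by
    intro l
    have hne : residual (EuclideanSpace.single l 1) c ≠ 0 := by
      intro h
      have h1 := norm_residual_single_sq hc l
      rw [h, norm_zero] at h1
      have := hlev l
      nlinarith
    have h1 : ((smallCoords l (residual (EuclideanSpace.single l 1) c)).card : ℝ) < n / 5 := by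
      by_contra h
      exact hsmall l ⟨hne, not_lt.mp h⟩
    have h2 : ((A l).card : ℝ) ≤
        (smallCoords l (residual (EuclideanSpace.single l 1) c)).card + 1 := by
      exact_mod_cast Finset.card_insert_le _ _
    linarith
  have hlarge : ∀ l j, j ∉ A l → κ / 1600 / n ≤ cross (rows c) 1 l j ^ 2 := by
    intro l j hj
    rw [Finset.mem_insert, not_or] at hj
    have h1 := hj.2
    simp only [smallCoords, Finset.mem_filter, Finset.mem_univ, true_and, not_and, not_lt] at h1
    have h2 := h1 hj.1
    rw [residual_single_apply, if_neg hj.1, sub_zero, norm_residual_single_sq hc] at h2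
    refine le_trans ?_ h2
    rw [div_div]
    gcongr
    exact hlev l
  refine ⟨Finset.univ \ (A i ∪ A k), ?_, fun j hj => ?_⟩
  · have h1 := Finset.le_card_sdiff (A i ∪ A k) Finset.univ
    have h2 := Finset.card_union_le (A i) (A k)
    rw [Finset.card_univ, Fintype.card_fin] at h1
    have h3 : n ≤ (Finset.univ \ (A i ∪ A k)).card + ((A i).card + (A k).card) := by omega
    have h4 : (n : ℝ) ≤ (Finset.univ \ (A i ∪ A k)).card + ((A i).card + (A k).card) := by
      exact_mod_cast h3
    have := hA i
    have := hA k
    linarith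
  · rw [Finset.mem_sdiff, Finset.mem_union, not_or] at hj
    exact ⟨hlarge i j hj.2.1, hlarge k j hj.2.2⟩

end RowsHat

/-! ### Whitening, the union bound and the conclusion -/

theorem hasLaw_whitened {n p : ℕ} {T : Matrix (Fin p) (Fin p) ℝ} (hT : T.PosDef) {Ω : Type*}
    [MeasurableSpace Ω] {P : Measure Ω} [IsProbabilityMeasure P]
    {X : Fin n → Ω → EuclideanSpace ℝ (Fin p)}
    (hX : ∀ i, HasLaw (X i) (multivariateGaussian 0 T) P) (hind : iIndepFun X P) :
    ∃ Y : Ω → Fin p → EuclideanSpace ℝ (Fin n),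
      HasLaw Y (Measure.pi fun _ => stdGaussian (EuclideanSpace ℝ (Fin n))) P ∧
      ∀ ω i, X i ω = Matrix.toEuclideanCLM (𝕜 := ℝ) (CFC.sqrt T) (rows (Y ω) i) := by
  set R := CFC.sqrt T with hR
  have hRR : R * R = T := CFC.sqrt_mul_sqrt_self T hT.posSemidef.nonneg
  have hRu : IsUnit R.det := by
    have h1 := (Matrix.isUnit_iff_isUnit_det _).mp hT.isUnit
    rw [← hRR, Matrix.det_mul] at h1
    exact isUnit_of_mul_isUnit_left h1
  have hinv : ∀ z, Matrix.toEuclideanCLM (𝕜 := ℝ) R⁻¹ (Matrix.toEuclideanCLM (𝕜 := ℝ) R z) = z := by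
    intro z
    rw [← mul_apply_eq_comp, ← map_mul, Matrix.nonsing_inv_mul _ hRu, map_one]
    rfl
  have hinv' : ∀ z, Matrix.toEuclideanCLM (𝕜 := ℝ) R (Matrix.toEuclideanCLM (𝕜 := ℝ) R⁻¹ z) = z := by
    intro z
    rw [← mul_apply_eq_comp, ← map_mul, Matrix.mul_nonsing_inv _ hRu, map_one]
    rfl
  let Z : Fin n → Ω → EuclideanSpace ℝ (Fin p) :=
    fun i ω => Matrix.toEuclideanCLM (𝕜 := ℝ) R⁻¹ (X i ω)
  have hmap : (multivariateGaussian 0 T).map (Matrix.toEuclideanCLM (𝕜 := ℝ) R⁻¹) =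
      stdGaussian (EuclideanSpace ℝ (Fin p)) := by
    rw [multivariateGaussian, Measure.map_map (by fun_prop) (by fun_prop)]
    have : (Matrix.toEuclideanCLM (𝕜 := ℝ) R⁻¹) ∘
        (fun x => 0 + Matrix.toEuclideanCLM (𝕜 := ℝ) (CFC.sqrt T) x) = id := by
      ext1 z
      simp only [Function.comp_apply, zero_add, id_eq]
      exact hinv z
    rw [this, Measure.map_id]
  have hZ : ∀ i, HasLaw (Z i) (stdGaussian (EuclideanSpace ℝ (Fin p))) P := fun i =>
    HasLaw.comp ⟨by fun_prop, hmap⟩ (hX i)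
  have hZind : iIndepFun Z P := hind.comp (fun _ => Matrix.toEuclideanCLM (𝕜 := ℝ) R⁻¹)
    fun _ => by fun_prop
  have hlaw := iIndepFun.hasLaw_pi hZ hZind
  exact ⟨fun ω => rows fun i => Z i ω, measurePreserving_rows.comp_hasLaw hlaw,
    fun ω i => (hinv' (X i ω)).symm⟩

/-- For a non-measurable `s` one passes to a measurable hull, which is why only an inequality is
claimed. -/
theorem measure_preimage_le_of_hasLaw {Ω α : Type*} [MeasurableSpace Ω] [MeasurableSpace α]
    {P : Measure Ω} {μ : Measure α} {Y : Ω → α} (hY : HasLaw Y μ P) (s : Set α) :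
    P {ω | Y ω ∈ s} ≤ μ s := by
  rw [← measure_toMeasurable s, ← hY.map_eq,
    Measure.map_apply_of_aemeasurable hY.aemeasurable (measurableSet_toMeasurable _ _), hY.map_eq]
  exact measure_mono fun ω h => subset_toMeasurable μ s h

theorem measure_not_regular_le {n p : ℕ} (hn : 20 ≤ n) (hpn : p ≤ n) {ε : ℝ} (hε : 0 < ε)
    (hε1 : ε ≤ 1) :
    (Measure.pi fun _ : Fin p => stdGaussian (EuclideanSpace ℝ (Fin n)))
      {c | ¬(LinearIndependent ℝ c ∧ (∀ i, |lev (rows c) 1 i - p / n| < ε) ∧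
        (∀ i, ¬(residual (EuclideanSpace.single i 1) c ≠ 0 ∧
          (n : ℝ) / 5 ≤ (smallCoords i (residual (EuclideanSpace.single i 1) c)).card)) ∧
        ‖design (rows c)‖ ^ 2 ≤ 256 * n)} ≤
      ENNReal.ofReal (5 * n * Real.exp (-(n * ε ^ 2 / 32))) := by
  set μ := Measure.pi fun _ : Fin p => stdGaussian (EuclideanSpace ℝ (Fin n))
  set q := Real.exp (-(n * ε ^ 2 / 32))
  have hn' : (20 : ℝ) ≤ n := by exact_mod_cast hn
  have hε2 : ε ^ 2 ≤ 1 := pow_le_one₀ hε.le hε1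
  have hq1 : Real.exp (-(n / 10)) ≤ q := by
    apply Real.exp_le_exp.mpr
    nlinarith
  have hq2 : Real.exp (-n) ≤ q := by
    apply Real.exp_le_exp.mpr
    nlinarith
  have hq : 0 < q := Real.exp_pos _
  have h0 : μ {c | ¬LinearIndependent ℝ c} = 0 :=
    ae_linearIndependent_stdGaussian (by simpa using hpn)
  have h1 : μ (⋃ i, {c | ε ≤ |lev (rows c) 1 i - p / n|}) ≤ ENNReal.ofReal (n * (2 * q)) := by
    refine (measure_iUnion_fintype_le _ _).trans ?_
    refine (Finset.sum_le_sum fun i _ => ?_).trans_eq ?_ (b := ∑ _i : Fin n, ENNReal.ofReal (2 * q))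
    · simp_rw [lev_eq_cross, cross_rows_one]
      exact measure_leverage_dev_le (by omega) hpn hε hε1 (by simp)
    · simp [ENNReal.ofReal_mul]
  have h2 : μ (⋃ i, {c | residual (EuclideanSpace.single i 1) c ≠ 0 ∧
      (n : ℝ) / 5 ≤ (smallCoords i (residual (EuclideanSpace.single i 1) c)).card}) ≤
      ENNReal.ofReal (n * (2 * q)) := by
    refine (measure_iUnion_fintype_le _ _).trans ?_
    refine (Finset.sum_le_sum fun i _ => ?_).trans_eq ?_ (b := ∑ _i : Fin n, ENNReal.ofReal (2 * q))
    · exact (measure_residual_smallCoords_le (by omega) i).trans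
        (ENNReal.ofReal_le_ofReal (by linarith))
    · simp [ENNReal.ofReal_mul]
  have h3 : μ {c | 256 * (n : ℝ) < ‖design (rows c)‖ ^ 2} ≤ ENNReal.ofReal q :=
    (measure_preimage_le_of_hasLaw ⟨measurable_rows.aemeasurable, measurePreserving_rows.map_eq⟩
      {x | 256 * (n : ℝ) < ‖design x‖ ^ 2}).trans ((measure_norm_design_gt_le hpn).trans
      (ENNReal.ofReal_le_ofReal hq2))
  calc _ ≤ μ ({c | ¬LinearIndependent ℝ c} ∪ ((⋃ i, {c | ε ≤ |lev (rows c) 1 i - p / n|}) ∪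
        ((⋃ i, {c | residual (EuclideanSpace.single i 1) c ≠ 0 ∧
          (n : ℝ) / 5 ≤ (smallCoords i (residual (EuclideanSpace.single i 1) c)).card}) ∪
          {c | 256 * (n : ℝ) < ‖design (rows c)‖ ^ 2}))) := by
        refine measure_mono fun c hc => ?_
        by_contra hcon
        simp only [Set.mem_union, Set.mem_iUnion, not_or, not_exists] at hcon
        exact hc ⟨not_not.mp hcon.1, fun i => not_le.mp (hcon.2.1 i), hcon.2.2.1,
          not_lt.mp hcon.2.2.2⟩
    _ ≤ 0 + (ENNReal.ofReal (n * (2 * q)) + (ENNReal.ofReal (n * (2 * q)) + ENNReal.ofReal q)) := by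
        refine (measure_union_le _ _).trans (add_le_add h0.le ?_)
        refine (measure_union_le _ _).trans (add_le_add h1 ?_)
        exact (measure_union_le _ _).trans (add_le_add h2 h3)
    _ = ENNReal.ofReal (n * (2 * q) + (n * (2 * q) + q)) := by
        rw [zero_add, ← ENNReal.ofReal_add (by positivity) hq.le,
          ← ENNReal.ofReal_add (by positivity) (by positivity)]
    _ ≤ _ := by
        apply ENNReal.ofReal_le_ofReal
        nlinarith

end Maronna

open Maronna in
/-- The probability bound is stated for the complementary event, in outer measure, so that it needs
no measurability of the event. -/
theorem mainTheorem7 (y : ℝ) (hy0 : 0 < y) (hy1 : y < 1) (u : ℝ → ℝ)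
    (hu : Maronna.WeightAssumptions u y) :
    ∃ C c c' : ℝ, 0 < C ∧ 0 < c ∧ 0 < c' ∧
      ∀ ε : ℝ, 0 < ε → ε < c' →
        ∃ δ : ℝ, 0 < δ ∧
          ∀ n p : ℕ, 0 < n → |(p : ℝ) / n - y| < δ →
            ∀ T : Matrix (Fin p) (Fin p) ℝ, T.PosDef →
              ∀ (Ω : Type*) [MeasurableSpace Ω] (P : Measure Ω) [IsProbabilityMeasure P]
                (X : Fin n → Ω → EuclideanSpace ℝ (Fin p)),
                (∀ i, HasLaw (X i) (multivariateGaussian 0 T) P) → iIndepFun X P →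
                  P.real {ω | ¬ Maronna.GoodSample u y T ε (fun i => X i ω)}
                    ≤ C * n * Real.exp (-(c * ε ^ 2 * n)) := by
  have hut := hu.pos _ (psiInv_pos hy0 hu).le
  -- The mixing constant is the one of `mixing_rows` with `κ = y (1 - y) / 4`, a lower bound for `h
  -- - h²` when `y/2 ≤ h ≤ (1 + y)/2`.
  obtain ⟨K, η₁, hK, hη₁, hclose⟩ := exists_weights_close hy0 hy1 hu
    (c := y * (1 - y) / 4 / 1600) (div_pos (div_pos (mul_pos hy0 (by linarith)) (by norm_num))
      (by norm_num))
  obtain ⟨η₂, hη₂, hexists⟩ := existsUnique_weights hy0 hu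
  -- Leverage accuracy `ε₁` gives weight accuracy `K * ε₁`, and the squared norm of the sample
  -- matrix is at most `256 * n`; hence `ε = L * ε₁`.
  set L := 256 * K with hL
  have hL0 : 0 < L := by positivity
  set η := min (min η₁ η₂) (min (min (y / 2) ((1 - y) / 2)) 1) with hη
  have hη0 : 0 < η := lt_min (lt_min hη₁ hη₂)
    (lt_min (lt_min (by positivity) (by linarith)) one_pos)
  -- The rate is `(ε / (2L))² / 32 = ε² / (128 L²)`. The factor `exp 20` makes the bound trivial for
  -- `n < 20`.
  refine ⟨Real.exp 20, 1 / (128 * L ^ 2), L * η, Real.exp_pos _, by positivity, by positivity,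
    fun ε hε hεη => ?_⟩
  obtain ⟨ε₁, rfl⟩ : ∃ ε₁, ε = L * ε₁ := ⟨ε / L, by field_simp⟩
  have hε₁ : 0 < ε₁ := pos_of_mul_pos_right hε hL0.le
  have hε₁η : ε₁ < η := lt_of_mul_lt_mul_left hεη hL0.le
  simp only [hη, lt_min_iff] at hε₁η
  obtain ⟨⟨hb1, hb2⟩, ⟨hb3, hb4⟩, hb5⟩ := hε₁η
  obtain ⟨δ, hδ, hδ'⟩ := hclose ε₁ hε₁ hb1
  -- Half of `ε₁` is spent on `|p/n - y|`, half on the deviation of the leverages from `p/n`.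
  refine ⟨min δ (ε₁ / 2), lt_min hδ (by positivity), fun n p hn hp T hT Ω _ P _ X hX hind => ?_⟩
  rw [lt_min_iff] at hp
  obtain ⟨hp1, hp2⟩ := hp
  have hn' : (0 : ℝ) < n := by exact_mod_cast hn
  have hexp : 1 / (128 * L ^ 2) * (L * ε₁) ^ 2 * n = n * (ε₁ / 2) ^ 2 / 32 := by
    field_simp
    ring
  rw [hexp]
  have hε₁sq : ε₁ ^ 2 ≤ 1 := pow_le_one₀ hε₁.le hb5.le
  rcases lt_or_ge n 20 with hn20 | hn20
  · refine measureReal_le_one.trans ?_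
    have h1 : (n : ℝ) ≤ 20 := by exact_mod_cast hn20.le
    have h2 : (1 : ℝ) ≤ n := by exact_mod_cast hn
    have h3 : 1 ≤ Real.exp 20 * Real.exp (-(n * (ε₁ / 2) ^ 2 / 32)) := by
      rw [← Real.exp_add]
      apply Real.one_le_exp
      nlinarith
    calc (1 : ℝ) ≤ 1 * n := by linarith
      _ ≤ Real.exp 20 * Real.exp (-(n * (ε₁ / 2) ^ 2 / 32)) * n := by gcongr
      _ = _ := by ring
  have hp2' := abs_lt.mp hp2
  have hpn : p ≤ n := by
    have h1 : (p : ℝ) / n ≤ 1 := by linarith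
    rw [div_le_one hn'] at h1
    exact_mod_cast h1
  obtain ⟨Y, hY, hXY⟩ := hasLaw_whitened hT hX hind
  have hbad : P {ω | ¬ GoodSample u y T (L * ε₁) (fun i => X i ω)} ≤
      ENNReal.ofReal (5 * n * Real.exp (-(n * (ε₁ / 2) ^ 2 / 32))) := by
    refine le_trans (measure_mono fun ω hω => ?_)
      ((measure_preimage_le_of_hasLaw hY _).trans
        (measure_not_regular_le hn20 hpn (ε := ε₁ / 2) (by positivity) (by linarith)))
    intro hreg
    obtain ⟨hli, hlev, hsmall, hdes⟩ := hreg
    apply hω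
    simp_rw [hXY]
    apply goodSample_of_sqrt hT
    have hS : (scatter (rows (Y ω)) 1).PosDef := by
      rw [scatter_rows_one]
      exact Matrix.posDef_gram_iff_linearIndependent.mpr hli
    have hlev' : ∀ i, |lev (rows (Y ω)) 1 i - y| ≤ ε₁ := fun i => by
      have h1 := abs_sub_le (lev (rows (Y ω)) 1 i) ((p : ℝ) / n) y
      have h2 := hlev i
      linarith
    have hmix := mixing_rows hn20 hli (κ := y * (1 - y) / 4)
      (div_pos (mul_pos hy0 (by linarith)) (by norm_num)) (fun i => by
        have h1 := abs_le.mp (hlev' i)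
        nlinarith [mul_nonneg (by linarith : 0 ≤ lev (rows (Y ω)) 1 i - y / 2)
          (by linarith : 0 ≤ (1 + y) / 2 - lev (rows (Y ω)) 1 i)]) hsmall
    have hLε : L * ε₁ = (K * ε₁) * 256 := by rw [hL]; ring
    rw [hLε]
    refine goodSample_one hu.pos hut hn hS (hexists n p _ hS fun i => (hlev' i).trans hb2.le)
      (by norm_num) (by positivity) (hδ' n p hn hp1 _ hS hlev' hmix) fun v => ?_
    have h1 : ∑ i, ((rows (Y ω) i).ofLp ⬝ᵥ v.ofLp) ^ 2 = ‖design (rows (Y ω)) v‖ ^ 2 := by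
      rw [norm_design_sq]
      refine Finset.sum_congr rfl fun i _ => ?_
      rw [EuclideanSpace.inner_eq_star_dotProduct, star_trivial]
    rw [h1]
    calc ‖design (rows (Y ω)) v‖ ^ 2 ≤ (‖design (rows (Y ω))‖ * ‖v‖) ^ 2 := by
          gcongr
          exact ContinuousLinearMap.le_opNorm _ _
      _ = ‖design (rows (Y ω))‖ ^ 2 * ‖v‖ ^ 2 := by ring
      _ ≤ 256 * n * ‖v‖ ^ 2 := by gcongr
      _ = _ := by ring
  have hreal := ENNReal.toReal_mono ENNReal.ofReal_ne_top hbad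
  rw [ENNReal.toReal_ofReal (by positivity)] at hreal
  refine hreal.trans ?_
  have h5 : (5 : ℝ) ≤ Real.exp 20 := by
    have := Real.add_one_le_exp (20 : ℝ)
    linarith
  gcongr
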